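/- **Theorem 1.** The two-stage approach can return an MBSP schedule whose cost is a $\Theta(n)$ factor above the optimum, even when both stages are solved optimally. This holds for every constant number $P\ge 2$ of processors, for the synchronous and for the asynchronous cost, with the following witness. *MBSP scheduling.* An instance is a DAG with $n$ nodes, compute weights $\omega$ and memory weights $\mu$, together with $P$ processors, a fast-memory capacity $r$, a cost $g$ per unit of data, and a synchronization cost $L$. Each processor $p$ has a fast memory holding a set $R_p$ of values with $\sum_{v\in R_p}\mu(v)\le r$ at all times; the slow memory is shared and unbounded, and holds exactly the sources at the start and must contain all sinks at the end. Processor $p$ can load a value from slow memory (cost $\mu(v)g$), save a value of $R_p$ to slow memory (cost $\mu(v)g$), compute a non-source node whose parents are all in $R_p$ (cost $\omega(v)$), and delete values from $R_p$ (cost $0$). An MBSP schedule is a sequence of supersteps; in each, every processor performs a sequence of computes and deletes, then saves, then deletes, then loads, and the saves of all processors are visible before the loads. The synchronous cost is the sum over the supersteps of (maximum compute cost over the processors) + (maximum save cost) + (maximum load cost) + $L$. The asynchronous cost is the largest finishing time of a processor when the operations of each processor are executed one after the other without waiting, except that a load of $v$ starts no earlier than the time at which $v$ first becomes available in slow memory: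 time $0$ for a source, and otherwise the earliest finishing time of a save of $v$ in the first superstep in which $v$ is saved. *First stage.* A BSP schedule assigns every node to one processor and one superstep, without any memory bound. A value can be sent from the processor that computes it to another one in the communication phase of any superstep not earlier than its computation; a node can be computed if each of its parents was computed earlier on the same processor, or was received by it in an earlier superstep. The cost is the sum over the supersteps of the maximum work of a processor, plus $g$ times the maximum over the processors of the larger of the amounts of data sent and received, plus $L$. Two variants are considered: the sources are computed like the other nodes, or the sources are not computed and are received from slow memory by each processor that needs them, in a communication phase. The first stage returns a BSP schedule of minimum cost. *Second stage.* Given a BSP schedule $\sigma$, the second stage returns an MBSP schedule of minimum (synchronous, respectively asynchronous) cost among all those that compute every non-source node exactly once, on the processor that $\sigma$ prescribes, and whose supersteps are obtained by splitting each superstep of $\sigma$ into consecutive ones; the saves, deletes and loads are free. *Witness.* For $d,m\ge1$, the zipper DAG consists of two groups $H_1,H_2$ of $d$ sources, two chains $u_1\to\dots\to u_m$ and $v_1\to\dots\to v_m$, with edges to $u_i$ from all of $H_1$ and to $v_i$ from all of $H_2$ if $i$ is odd, and to $u_i$ from all of $H_2$ and to $v_i$ from all of $H_1$ if $i$ is even;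 and, if $P\ge3$, of $P-2$ further components, each consisting of $d$ sources and a chain of $m$ nodes, with an edge from each of these sources to each of these chain nodes. It has $n=P(d+m)$ nodes. All weights are $1$, $r=d+2$, and $L=0$. *Claim.* For every $P\ge2$, every constant $g\ge 2P$ and every $K$, there are constants $c,C>0$, depending only on $P,g,K$, such that for all $d\ge1$ and $m$ with $Pdg+d<m\le Kd$ (so $d,m=\Theta(n)$; such $m$ exist for all large $d$ if $K>Pg+1$), for both BSP variants and both cost models: optimal BSP schedules, and MBSP schedules of minimum cost $\mathrm{OPT}$, exist; $\mathrm{OPT}>0$; and for **every** optimal BSP schedule, an optimal second stage exists, and the cost of its outcome lies between $c\,n\cdot\mathrm{OPT}$ and $C\,n\cdot\mathrm{OPT}$. -/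

import Mathlib

open scoped NNReal

namespace MBSP

/-! ### Problem instances -/

/-- A computational DAG: compute weights `ω` and memory weights `μ` on the nodes. -/
structure CompDAG (V : Type) where
  edge : V → V → Prop
  acyclic : ∀ v, ¬ Relation.TransGen edge v v
  ω : V → ℝ≥0
  μ : V → ℝ≥0

/-- A node without parents. -/
def CompDAG.IsSource {V : Type} (G : CompDAG V) (v : V) : Prop := ∀ u, ¬ G.edge u v

/-- A node without children. -/
def CompDAG.IsSink {V : Type} (G : CompDAG V) (v : V) : Prop := ∀ w, ¬ G.edge v w

/-- Architecture parameters: the capacity `r` of each fast memory, the cost `g` of moving one unit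
of data, the synchronization cost `L`. The number `P` of processors is kept as a separate
parameter; the processors are the elements of `Fin P`. -/
structure Arch where
  r : ℝ≥0
  g : ℝ≥0
  L : ℝ≥0

/-! ### Transition rules and pebbling sequences on one processor -/

/-- The transition rules of a fixed processor. -/
inductive Op (V : Type) where
  | load (v : V)
  | save (v : V)
  | compute (v : V)
  | delete (v : V)

/-- The node computed by a transition rule, if it is a compute rule. -/
def Op.computed? {V : Type} : Op V → Option V
  | .compute v => some v
  | _ => none

/-- The state seen by one processor: its red pebbles, and the blue pebbles known to it. -/
structure State (V : Type) where
  red : Finset V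
  blue : Finset V

/-- The prerequisite of a transition rule. -/
def Op.Allowed {V : Type} (G : CompDAG V) : Op V → State V → Prop
  | .load v, s => v ∈ s.blue
  | .save v, s => v ∈ s.red
  | .compute v, s => ¬ G.IsSource v ∧ ∀ u, G.edge u v → u ∈ s.red
  | .delete v, s => v ∈ s.red

/-- The effect of a transition rule. -/
def Op.apply {V : Type} [DecidableEq V] : Op V → State V → State V
  | .load v, s => ⟨insert v s.red, s.blue⟩
  | .save v, s => ⟨s.red, insert v s.blue⟩
  | .compute v, s => ⟨insert v s.red, s.blue⟩
  | .delete v, s => ⟨s.red.erase v, s.blue⟩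

/-- The cost of a transition rule. -/
def Op.cost {V : Type} (G : CompDAG V) (A : Arch) : Op V → ℝ≥0
  | .load v => G.μ v * A.g
  | .save v => G.μ v * A.g
  | .compute v => G.ω v
  | .delete _ => 0

/-- The total cost of a sequence of transition rules. -/
def seqCost {V : Type} (G : CompDAG V) (A : Arch) (l : List (Op V)) : ℝ≥0 :=
  (l.map (Op.cost G A)).sum

/-- The state reached from `s` by a sequence of transition rules. -/
def run {V : Type} [DecidableEq V] : State V → List (Op V) → State V
  | s, [] => s
  | s, o :: l => run (o.apply s) l

/-- The sequence of rules is a valid pebbling sequence from `s`: all prerequisites hold, and the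
memory bound holds in every state, including the first and the last one. -/
def ValidSeq {V : Type} [DecidableEq V] (G : CompDAG V) (A : Arch) :
    State V → List (Op V) → Prop
  | s, [] => ∑ v ∈ s.red, G.μ v ≤ A.r
  | s, o :: l => ∑ v ∈ s.red, G.μ v ≤ A.r ∧ o.Allowed G s ∧ ValidSeq G A (o.apply s) l

/-! ### Supersteps and schedules -/

/-- A superstep on one processor: a compute phase of compute and delete rules, followed by saves,
deletes and loads of the listed nodes, in this order. -/
structure ProcStep (V : Type) where
  comp : List (Op V)
  comp_rules : ∀ o ∈ comp, ∃ v, o = .compute v ∨ o = .delete v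
  save : List V
  del : List V
  load : List V

/-- A superstep: one superstep on each processor. -/
abbrev Superstep (V : Type) (P : ℕ) : Type := Fin P → ProcStep V

/-- A sequence of supersteps. -/
abbrev Schedule (V : Type) (P : ℕ) : Type := List (Superstep V P)

/-- A configuration between two supersteps: the red pebbles of each processor, and the blue
pebbles, which all processors agree on at these points. -/
structure Config (V : Type) (P : ℕ) where
  red : Fin P → Finset V
  blue : Finset V

section
variable {V : Type} [DecidableEq V] {P : ℕ}

/-- The state of processor `p` after its compute phase. -/
def Superstep.afterComp (Ψ : Superstep V P) (c : Config V P) (p : Fin P) : State V :=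
  run ⟨c.red p, c.blue⟩ (Ψ p).comp

/-- The state of processor `p` after its save phase. -/
def Superstep.afterSave (Ψ : Superstep V P) (c : Config V P) (p : Fin P) : State V :=
  run (Ψ.afterComp c p) ((Ψ p).save.map .save)

/-- The blue pebbles after the save phases of all processors. -/
def Superstep.newBlue (Ψ : Superstep V P) (c : Config V P) : Finset V :=
  Finset.univ.biUnion fun p => (Ψ.afterSave c p).blue

/-- The state of processor `p` at the start of its delete phase, with the shared blue pebbles. -/
def Superstep.synced (Ψ : Superstep V P) (c : Config V P) (p : Fin P) : State V :=
  ⟨(Ψ.afterSave c p).red, Ψ.newBlue c⟩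

/-- The state of processor `p` after its delete phase. -/
def Superstep.afterDel (Ψ : Superstep V P) (c : Config V P) (p : Fin P) : State V :=
  run (Ψ.synced c p) ((Ψ p).del.map .delete)

/-- The state of processor `p` after its load phase. -/
def Superstep.afterLoad (Ψ : Superstep V P) (c : Config V P) (p : Fin P) : State V :=
  run (Ψ.afterDel c p) ((Ψ p).load.map .load)

/-- The superstep can be executed from the configuration `c`. -/
def Superstep.Valid (G : CompDAG V) (A : Arch) (Ψ : Superstep V P) (c : Config V P) : Prop :=
  ∀ p, ValidSeq G A ⟨c.red p, c.blue⟩ (Ψ p).comp ∧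
    ValidSeq G A (Ψ.afterComp c p) ((Ψ p).save.map .save) ∧
    ValidSeq G A (Ψ.synced c p) ((Ψ p).del.map .delete) ∧
    ValidSeq G A (Ψ.afterDel c p) ((Ψ p).load.map .load)

/-- The finishing configuration of a superstep started in `c`; deletes and loads leave the blue
pebbles unchanged. -/
def Superstep.next (Ψ : Superstep V P) (c : Config V P) : Config V P :=
  ⟨fun p => (Ψ.afterLoad c p).red, Ψ.newBlue c⟩

open Classical in
/-- The initial configuration: blue pebbles exactly on the sources, no red pebbles. -/
noncomputable def initial [Fintype V] (G : CompDAG V) (P : ℕ) : Config V P :=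
  ⟨fun _ => ∅, Finset.univ.filter fun v => G.IsSource v⟩

/-- The supersteps can be executed one after the other from `c`, and then all sinks have a blue
pebble. -/
def ValidFrom (G : CompDAG V) (A : Arch) : Config V P → Schedule V P → Prop
  | c, [] => ∀ v, G.IsSink v → v ∈ c.blue
  | c, Ψ :: S => Ψ.Valid G A c ∧ ValidFrom G A (Ψ.next c) S

/-- `S` is an MBSP schedule of `G` on the architecture `A` with `P` processors. -/
def IsSchedule [Fintype V] (G : CompDAG V) (A : Arch) (S : Schedule V P) : Prop :=
  ValidFrom G A (initial G P) S

/-! ### Synchronous and asynchronous cost -/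

/-- The synchronous cost of a superstep. The suprema are maxima over the processors. -/
noncomputable def Superstep.cost (G : CompDAG V) (A : Arch) (Ψ : Superstep V P) : ℝ≥0 :=
  (Finset.univ.sup fun p => seqCost G A (Ψ p).comp) +
  (Finset.univ.sup fun p => seqCost G A ((Ψ p).save.map .save)) +
  (Finset.univ.sup fun p => seqCost G A ((Ψ p).load.map .load)) + A.L

/-- The synchronous cost of a schedule. -/
noncomputable def syncCost (G : CompDAG V) (A : Arch) (S : Schedule V P) : ℝ≥0 :=
  (S.map (Superstep.cost G A)).sum

/-- The finishing time of the first (hence earliest) save of `v` in a save phase that is started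
at time `t`; `⊤` if `v` is not saved. -/
noncomputable def saveTime (G : CompDAG V) (A : Arch) (v : V) : ℝ≥0 → List V → WithTop ℝ≥0
  | _, [] => ⊤
  | t, w :: l =>
    if w = v then ((t + (Op.save w).cost G A : ℝ≥0) : WithTop ℝ≥0)
    else saveTime G A v (t + (Op.save w).cost G A) l

/-- The finishing time of a load phase that is started at time `t`, when the node `v` becomes
available in slow memory at time `Γ v`. -/
noncomputable def loadTime (G : CompDAG V) (A : Arch) (Γ : V → WithTop ℝ≥0) :
    ℝ≥0 → List V → ℝ≥0
  | t, [] => t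
  | t, v :: l => loadTime G A Γ (max t ((Γ v).untopD 0) + (Op.load v).cost G A) l

/-- The clock of each processor, and the time at which each node first becomes available in slow
memory (`⊤`: not yet available). -/
structure Clock (V : Type) (P : ℕ) where
  time : Fin P → ℝ≥0
  avail : V → WithTop ℝ≥0

/-- The availability times after the save phases of a superstep. Only the first superstep that
saves a node determines its availability time. -/
noncomputable def Superstep.newAvail (G : CompDAG V) (A : Arch) (Ψ : Superstep V P)
    (k : Clock V P) (v : V) : WithTop ℝ≥0 :=
  if k.avail v = ⊤ then
    Finset.univ.inf fun p => saveTime G A v (k.time p + seqCost G A (Ψ p).comp) (Ψ p).save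
  else k.avail v

/-- The clocks after an asynchronous execution of a superstep. -/
noncomputable def Superstep.tick (G : CompDAG V) (A : Arch) (Ψ : Superstep V P)
    (k : Clock V P) : Clock V P :=
  ⟨fun p => loadTime G A (Ψ.newAvail G A k)
      (k.time p + seqCost G A (Ψ p).comp + seqCost G A ((Ψ p).save.map .save)) (Ψ p).load,
    Ψ.newAvail G A k⟩

open Classical in
/-- At time `0`, exactly the sources are available in slow memory. -/
noncomputable def startClock (G : CompDAG V) (P : ℕ) : Clock V P :=
  ⟨fun _ => 0, fun v => if G.IsSource v then 0 else ⊤⟩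

/-- The asynchronous cost of a schedule: the largest finishing time over the processors. -/
noncomputable def asyncCost (G : CompDAG V) (A : Arch) (S : Schedule V P) : ℝ≥0 :=
  Finset.univ.sup (S.foldl (fun k Ψ => Superstep.tick G A Ψ k) (startClock G P)).time

/-- The two ways of evaluating a schedule. -/
inductive CostModel where
  | sync
  | async

/-- The cost of an MBSP schedule in the given cost model. -/
noncomputable def cost (M : CostModel) (G : CompDAG V) (A : Arch) (S : Schedule V P) : ℝ≥0 :=
  match M with
  | .sync => syncCost G A S
  | .async => asyncCost G A S

/-- `S` is an MBSP schedule of minimum cost. -/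
def IsOptimal [Fintype V] (M : CostModel) (G : CompDAG V) (A : Arch) (S : Schedule V P) : Prop :=
  IsSchedule G A S ∧ ∀ S' : Schedule V P, IsSchedule G A S' → cost M G A S ≤ cost M G A S'

end

/-! ### First stage: BSP scheduling without a memory bound -/

/-- The two ways to treat the sources of the DAG in BSP: they are computed like any other node, or
they are not computed and each processor that needs them loads them from slow memory. -/
inductive BSPVariant where
  | computedSources
  | loadedSources

/-- The nodes that have to be computed in a BSP schedule. -/
def BSPVariant.Computes {V : Type} (X : BSPVariant) (G : CompDAG V) (v : V) : Prop :=
  match X with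
  | .computedSources => True
  | .loadedSources => ¬ G.IsSource v

/-- A BSP schedule with supersteps `0, …, steps - 1`: node `v` is computed on processor `proc v`
in superstep `step v`. A triple `(v, q, s)` in `comm` means that processor `q` receives the value
of `v` in the communication phase of superstep `s`: directly from processor `proc v`, or from slow
memory if `v` is not computed (`proc v` and `step v` then have no meaning). -/
structure BSPSchedule (V : Type) (P : ℕ) where
  steps : ℕ
  proc : V → Fin P
  step : V → ℕ
  comm : Finset (V × Fin P × ℕ)

section
variable {V : Type} {P : ℕ}

/-- Validity of a BSP schedule: values are sent only after they are computed, and every parent of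
a node is present on the processor of this node, because it was computed there, or because it was
received in an earlier superstep. -/
structure BSPSchedule.Valid (X : BSPVariant) (G : CompDAG V) (σ : BSPSchedule V P) : Prop where
  step_lt : ∀ v, X.Computes G v → σ.step v < σ.steps
  comm_lt : ∀ v q s, (v, q, s) ∈ σ.comm → s < σ.steps
  comm_computed : ∀ v q s, (v, q, s) ∈ σ.comm → X.Computes G v → σ.step v ≤ s
  edge : ∀ u v, G.edge u v →
    (X.Computes G u ∧ σ.proc u = σ.proc v ∧ σ.step u ≤ σ.step v) ∨
    ∃ s, s < σ.step v ∧ (u, σ.proc v, s) ∈ σ.comm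

open Classical in
/-- The compute weight of processor `p` in superstep `s`. -/
noncomputable def BSPSchedule.work [Fintype V] (X : BSPVariant) (G : CompDAG V)
    (σ : BSPSchedule V P) (p : Fin P) (s : ℕ) : ℝ≥0 :=
  ∑ v with X.Computes G v ∧ σ.proc v = p ∧ σ.step v = s, G.ω v

open Classical in
/-- The amount of data sent by processor `p` in superstep `s`. -/
noncomputable def BSPSchedule.sent (X : BSPVariant) (G : CompDAG V)
    (σ : BSPSchedule V P) (p : Fin P) (s : ℕ) : ℝ≥0 :=
  ∑ x ∈ σ.comm with X.Computes G x.1 ∧ σ.proc x.1 = p ∧ x.2.2 = s, G.μ x.1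

open Classical in
/-- The amount of data received by processor `p` in superstep `s`. -/
noncomputable def BSPSchedule.received (G : CompDAG V)
    (σ : BSPSchedule V P) (p : Fin P) (s : ℕ) : ℝ≥0 :=
  ∑ x ∈ σ.comm with x.2.1 = p ∧ x.2.2 = s, G.μ x.1

/-- The BSP cost: in each superstep, the maximal work, `g` times the `h`-relation, and `L`. -/
noncomputable def BSPSchedule.cost [Fintype V] (X : BSPVariant) (G : CompDAG V) (A : Arch)
    (σ : BSPSchedule V P) : ℝ≥0 :=
  ∑ s ∈ Finset.range σ.steps,
    ((Finset.univ.sup fun p => σ.work X G p s) +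
      A.g * (Finset.univ.sup fun p => max (σ.sent X G p s) (σ.received G p s)) + A.L)

/-- `σ` is a BSP schedule of minimum cost. -/
def BSPSchedule.IsOptimal [Fintype V] (X : BSPVariant) (G : CompDAG V) (A : Arch)
    (σ : BSPSchedule V P) : Prop :=
  σ.Valid X G ∧ ∀ σ' : BSPSchedule V P, σ'.Valid X G → σ.cost X G A ≤ σ'.cost X G A

/-! ### Second stage: cache management for a fixed BSP schedule -/

/-- The sequence of nodes computed by processor `p` over the whole MBSP schedule. -/
def computeSeq (S : Schedule V P) (p : Fin P) : List V :=
  S.flatMap fun Ψ => (Ψ p).comp.filterMap Op.computed?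

/-- The MBSP schedule `S` executes the computations of the BSP schedule `σ`: every non-source node
is computed exactly once, on the processor given by `σ`, and every superstep of `σ` is split into
consecutive supersteps of `S` (superstep `k` of `S` belongs to superstep `f k` of `σ`). The saves,
deletes and loads are free. -/
def Refines [DecidableEq V] (G : CompDAG V) (σ : BSPSchedule V P) (S : Schedule V P) : Prop :=
  (∀ v, ¬ G.IsSource v → (computeSeq S (σ.proc v)).count v = 1) ∧
  ∃ f : ℕ → ℕ, Monotone f ∧ ∀ (k : ℕ) (hk : k < S.length) (p : Fin P) (v : V),
    Op.compute v ∈ (S[k] p).comp → σ.proc v = p ∧ σ.step v = f k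

/-- `T` is the outcome of an optimal second stage for the BSP schedule `σ`: it has minimum cost
among all MBSP schedules that execute the computations of `σ`. -/
def IsOptimalRefinement [Fintype V] [DecidableEq V] (M : CostModel) (G : CompDAG V) (A : Arch)
    (σ : BSPSchedule V P) (T : Schedule V P) : Prop :=
  IsSchedule G A T ∧ Refines G σ T ∧
    ∀ T' : Schedule V P, IsSchedule G A T' → Refines G σ T' → cost M G A T ≤ cost M G A T'

end

/-! ### The zipper DAG -/

/-- For each `k < P`, a group of `d` nodes `(k, inl j)` and a chain of `m` nodes `(k, inr i)`. -/
abbrev ZipperNode (P d m : ℕ) : Type := Fin P × (Fin d ⊕ Fin m)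

/-- The edges of the zipper DAG. Chains `0` and `1` receive edges from the groups `0` and `1` in an
alternating fashion; every further chain `k ≥ 2` receives edges from its own group `k` only. -/
inductive ZipperEdge (P d m : ℕ) : ZipperNode P d m → ZipperNode P d m → Prop
  | chain (k : Fin P) (i i' : Fin m) (h : i'.val = i.val + 1) :
      ZipperEdge P d m (k, .inr i) (k, .inr i')
  | own (k : Fin P) (j : Fin d) (i : Fin m) (h : 2 ≤ k.val ∨ i.val % 2 = 0) :
      ZipperEdge P d m (k, .inl j) (k, .inr i)
  | cross (k k' : Fin P) (j : Fin d) (i : Fin m) (hk : k.val < 2) (hk' : k'.val < 2)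
      (hne : k ≠ k') (h : i.val % 2 = 1) :
      ZipperEdge P d m (k', .inl j) (k, .inr i)

/-- The position of a node in a topological order. -/
def zipperRank {P d m : ℕ} : ZipperNode P d m → ℕ
  | (_, .inl _) => 0
  | (_, .inr i) => i.val + 1

theorem zipperRank_lt {P d m : ℕ} {u v : ZipperNode P d m} (h : ZipperEdge P d m u v) :
    zipperRank u < zipperRank v := by
  cases h <;> simp only [zipperRank] <;> omega

theorem zipper_acyclic {P d m : ℕ} (v : ZipperNode P d m) :
    ¬ Relation.TransGen (ZipperEdge P d m) v v := by
  have key : ∀ w, Relation.TransGen (ZipperEdge P d m) v w → zipperRank v < zipperRank w := by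
    intro w h
    induction h with
    | single h => exact zipperRank_lt h
    | tail _ h ih => exact ih.trans (zipperRank_lt h)
  exact fun h => lt_irrefl _ (key v h)

/-- The zipper DAG with uniform weights. -/
def zipper (P d m : ℕ) : CompDAG (ZipperNode P d m) where
  edge := ZipperEdge P d m
  acyclic := zipper_acyclic
  ω := fun _ => 1
  μ := fun _ => 1

/-- The architecture with fast memory capacity `d + 2` and no synchronization cost. -/
noncomputable def zipperArch (d : ℕ) (g : ℝ≥0) : Arch := ⟨d + 2, g, 0⟩

end MBSP

open MBSP

/-! The capacity `d + 2` is exactly what a chain node with a chain parent needs: one group of `d`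
sources, the parent and the node itself. Along the first chain the required group alternates. A
processor that computes two consecutive nodes must therefore drop one group completely and load the
other, at cost `d * g`; moving the chain to a processor that already holds the right group costs
only one save and one load.

A good MBSP schedule keeps each group on one processor and lets the first two chains hop between two
processors. Its cost is linear, at most `6 * P * m * g` (`exists_schedule_linear_cost`), while
computing one chain gives `m ≤ P * OPT` (`le_totalCost`).

The first stage does not see the memory bound. Keeping every chain on one processor costs at most `P
* d * g + d + m < 2 * m`, and each superstep with communication costs at least `g ≥ 4`, so an
optimal BSP schedule has fewer than `m / 2` such supersteps. The first chain changes its processor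
at most once in each of them (`card_switches_le`), hence at least `m / 4` of its nodes stay on the
processor of their predecessor (`le_four_mul_card_stays`). Each of these nodes forces `d` loads
(`switches_le_totalCost`), so any second stage costs at least `m * d * g / (4 * P)`. Since `m ≤ K *
d`, this is a factor of order `n` above the optimum. Conversely, reloading all parents for each node
refines any BSP schedule at cost `O(n * d * g)` (`exists_refinement_quadratic_cost`).

Both cost models are handled at once through `totalCost`, the sum over all rules: up to a factor `P`
it equals either cost. Lower bounds on it follow from a potential argument on single rules
(`Steps.sum_le_cost_add_credit`). Minima exist because all costs have the form `a + b * g` with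
natural `a`, `b`. -/

namespace MBSP

/-! ### Synchronous, asynchronous and total cost agree up to the factor `P` -/

section CostComparison
variable {V : Type} {P : ℕ}

/-- The cost of all transition rules of a processor in a superstep. -/
noncomputable def ProcStep.cost (G : CompDAG V) (A : Arch) (ψ : ProcStep V) : ℝ≥0 :=
  seqCost G A ψ.comp + seqCost G A (ψ.save.map .save) + seqCost G A (ψ.load.map .load)

/-- The cost of all transition rules of all processors in a schedule. -/
noncomputable def totalCost (G : CompDAG V) (A : Arch) (S : Schedule V P) : ℝ≥0 :=
  (S.map fun Ψ => ∑ p, (Ψ p).cost G A).sum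

theorem syncCost_le_totalCost (G : CompDAG V) (A : Arch) (hL : A.L = 0) (S : Schedule V P) :
    syncCost G A S ≤ totalCost G A S := by
  unfold syncCost totalCost
  refine List.sum_le_sum fun Ψ _ => ?_
  have h : ∀ f : Fin P → ℝ≥0, Finset.univ.sup f ≤ ∑ p, f p := fun f =>
    Finset.sup_le fun p hp => Finset.single_le_sum (fun _ _ => zero_le) hp
  simp only [Superstep.cost, ProcStep.cost, Finset.sum_add_distrib, hL, add_zero]
  gcongr <;> exact h _

theorem totalCost_le_mul_syncCost (G : CompDAG V) (A : Arch) (S : Schedule V P) :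
    totalCost G A S ≤ P * syncCost G A S := by
  unfold syncCost totalCost
  rw [← List.sum_map_mul_left]
  refine List.sum_le_sum fun Ψ _ => ?_
  have h : ∀ p ∈ Finset.univ, (Ψ p).cost G A ≤ Superstep.cost G A Ψ := by
    intro p hp
    refine le_trans ?_ (le_add_of_nonneg_right zero_le)
    unfold ProcStep.cost
    gcongr
    · exact Finset.le_sup (f := fun p => seqCost G A (Ψ p).comp) hp
    · exact Finset.le_sup (f := fun p => seqCost G A ((Ψ p).save.map .save)) hp
    · exact Finset.le_sup (f := fun p => seqCost G A ((Ψ p).load.map .load)) hp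
  simpa using Finset.sum_le_card_nsmul _ _ _ h

theorem seqCost_cons (G : CompDAG V) (A : Arch) (o : Op V) (l : List (Op V)) :
    seqCost G A (o :: l) = o.cost G A + seqCost G A l := by
  simp [seqCost]

theorem loadTime_le (G : CompDAG V) (A : Arch) (Γ : V → WithTop ℝ≥0) (l : List V) (t τ : ℝ≥0)
    (ht : t ≤ τ) (hΓ : ∀ v, (Γ v).untopD 0 ≤ τ) :
    loadTime G A Γ t l ≤ τ + seqCost G A (l.map .load) := by
  induction l generalizing t τ with
  | nil => simpa [loadTime, seqCost] using ht
  | cons v l ih =>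
    rw [List.map_cons, seqCost_cons, ← add_assoc]
    refine ih _ _ ?_ fun w => (hΓ w).trans le_self_add
    gcongr
    exact max_le ht (hΓ v)

theorem le_loadTime (G : CompDAG V) (A : Arch) (Γ : V → WithTop ℝ≥0) (l : List V) (t : ℝ≥0) :
    t + seqCost G A (l.map .load) ≤ loadTime G A Γ t l := by
  induction l generalizing t with
  | nil => simp [loadTime, seqCost]
  | cons v l ih =>
    rw [List.map_cons, seqCost_cons, ← add_assoc]
    refine le_trans ?_ (ih _)
    gcongr
    exact le_max_left _ _

variable [DecidableEq V]

theorem untopD_saveTime_le (G : CompDAG V) (A : Arch) (v : V) (l : List V) (t : ℝ≥0) :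
    (saveTime G A v t l).untopD 0 ≤ t + seqCost G A (l.map .save) := by
  induction l generalizing t with
  | nil => simp [saveTime]
  | cons w l ih =>
    rw [List.map_cons, seqCost_cons, ← add_assoc]
    unfold saveTime
    split
    · rw [WithTop.untopD_coe]; exact le_self_add
    · exact ih _

/-- Here `τ` plays the role of the elapsed synchronous time. It has to bound the availability times
along with the clocks, since a load may wait for a save on another processor; all saves end by `τ`
plus the maximal compute and save costs, which is when synchronous loads begin. -/
theorem Superstep.tick_le (G : CompDAG V) (A : Arch) (Ψ : Superstep V P) (k : Clock V P) (τ : ℝ≥0)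
    (ht : ∀ p, k.time p ≤ τ) (ha : ∀ v, (k.avail v).untopD 0 ≤ τ) :
    (∀ p, (Ψ.tick G A k).time p ≤ τ + Ψ.cost G A) ∧
      ∀ v, ((Ψ.tick G A k).avail v).untopD 0 ≤ τ + Ψ.cost G A := by
  set a := Finset.univ.sup fun p => seqCost G A (Ψ p).comp
  set b := Finset.univ.sup fun p => seqCost G A ((Ψ p).save.map .save)
  set e := Finset.univ.sup fun p => seqCost G A ((Ψ p).load.map .load)
  have hcost : Ψ.cost G A = a + b + e + A.L := rfl
  have hA : ∀ p, seqCost G A (Ψ p).comp ≤ a := fun p =>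
    Finset.le_sup (f := fun p => seqCost G A (Ψ p).comp) (Finset.mem_univ p)
  have hB : ∀ p, seqCost G A ((Ψ p).save.map .save) ≤ b := fun p =>
    Finset.le_sup (f := fun p => seqCost G A ((Ψ p).save.map .save)) (Finset.mem_univ p)
  have hE : ∀ p, seqCost G A ((Ψ p).load.map .load) ≤ e := fun p =>
    Finset.le_sup (f := fun p => seqCost G A ((Ψ p).load.map .load)) (Finset.mem_univ p)
  have hav : ∀ v, (Ψ.newAvail G A k v).untopD 0 ≤ τ + a + b := by
    intro v
    unfold Superstep.newAvail
    split
    -- The default value reads `⊤` as time `0`, so values that are never saved satisfy the bound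
    -- trivially and no validity of the schedule is needed.
    · refine Finset.inf_induction (p := fun x : WithTop ℝ≥0 => x.untopD 0 ≤ τ + a + b)
        (by simp) (fun x hx y hy => ?_) (fun p _ => ?_)
      · rcases min_choice x y with h | h <;> rw [h] <;> assumption
      · refine (untopD_saveTime_le G A v _ _).trans ?_
        gcongr
        exacts [ht p, hA p, hB p]
    · exact (ha v).trans (by rw [add_assoc]; exact le_self_add)
  refine ⟨fun p => ?_, fun v => (hav v).trans ?_⟩
  · refine (loadTime_le G A _ _ _ (τ + a + b) ?_ hav).trans ?_
    · gcongr
      exacts [ht p, hA p, hB p]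
    · calc _ ≤ τ + a + b + e := by gcongr; exact hE p
        _ ≤ τ + a + b + e + A.L := le_self_add
        _ = _ := by rw [hcost]; ring
  · calc _ ≤ τ + a + b + (e + A.L) := le_self_add
      _ = _ := by rw [hcost]; ring

theorem asyncCost_le_syncCost (G : CompDAG V) (A : Arch) (S : Schedule V P) :
    asyncCost G A S ≤ syncCost G A S := by
  have key : ∀ (S : Schedule V P) (k : Clock V P) (τ : ℝ≥0), (∀ p, k.time p ≤ τ) →
      (∀ v, (k.avail v).untopD 0 ≤ τ) → ∀ p,
      (S.foldl (fun k Ψ => Superstep.tick G A Ψ k) k).time p ≤ τ + syncCost G A S := by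
    intro S
    induction S with
    | nil => intro k τ ht _ p; simpa [syncCost] using ht p
    | cons Ψ S ih =>
      intro k τ ht ha p
      obtain ⟨h1, h2⟩ := Ψ.tick_le G A k τ ht ha
      have := ih _ _ h1 h2 p
      simpa [syncCost, add_assoc] using this
  refine Finset.sup_le fun p _ => ?_
  refine (key S _ 0 (fun p => le_rfl) (fun v => ?_) p).trans (by simp)
  simp only [startClock]
  split <;> simp

/-- Waiting only delays a processor: each clock advances by at least the cost of its own rules. The
sum of the final clocks thus dominates the total cost, and it is at most `P` times their maximum. -/
theorem totalCost_le_mul_asyncCost (G : CompDAG V) (A : Arch) (S : Schedule V P) :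
    totalCost G A S ≤ P * asyncCost G A S := by
  have key : ∀ (S : Schedule V P) (k : Clock V P),
      ∑ p, k.time p + totalCost G A S ≤
        ∑ p, (S.foldl (fun k Ψ => Superstep.tick G A Ψ k) k).time p := by
    intro S
    induction S with
    | nil => intro k; simp [totalCost]
    | cons Ψ S ih =>
      intro k
      refine le_trans ?_ (ih (Ψ.tick G A k))
      simp only [totalCost, List.map_cons, List.sum_cons, ← add_assoc, ← Finset.sum_add_distrib]
      gcongr with p _
      refine le_trans (le_of_eq ?_) (le_loadTime G A _ _ _)
      simp only [ProcStep.cost, add_assoc]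
  have h := (le_add_of_nonneg_left zero_le).trans (key S (startClock G P))
  refine h.trans ?_
  have h2 := Finset.sum_le_card_nsmul Finset.univ
    (S.foldl (fun k Ψ => Superstep.tick G A Ψ k) (startClock G P)).time (asyncCost G A S)
    fun p hp => Finset.le_sup hp
  simpa using h2

theorem cost_le_totalCost (M : CostModel) (G : CompDAG V) (A : Arch) (hL : A.L = 0)
    (S : Schedule V P) : cost M G A S ≤ totalCost G A S := by
  cases M
  · exact syncCost_le_totalCost G A hL S
  · exact (asyncCost_le_syncCost G A S).trans (syncCost_le_totalCost G A hL S)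

theorem totalCost_le_mul_cost (M : CostModel) (G : CompDAG V) (A : Arch) (S : Schedule V P) :
    totalCost G A S ≤ P * cost M G A S := by
  cases M
  · exact totalCost_le_mul_syncCost G A S
  · exact totalCost_le_mul_asyncCost G A S

end CostComparison

/-! ### Existence of schedules of minimum cost -/

section Minima

/-- The sums of multiples of `1` and `g`: the possible costs for a DAG with unit weights. -/
def costLattice (g : ℝ≥0) : AddSubmonoid ℝ≥0 := AddSubmonoid.closure {1, g}

/-- There are infinitely many schedules, so the infimum of their real costs needs an argument. By
Dickson's lemma `ℕ × ℕ` is well-quasi-ordered; its monotone image in `ℝ≥0` is partially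
well-ordered, and every nonempty subset of that image has a least element. -/
theorem exists_minimal_of_mem_costLattice {α : Type*} (g : ℝ≥0) (Q : α → Prop) (F : α → ℝ≥0)
    (hF : ∀ a, Q a → F a ∈ costLattice g) (hne : ∃ a, Q a) :
    ∃ a, Q a ∧ ∀ b, Q b → F a ≤ F b := by
  have hpwo : (Set.range fun x : ℕ × ℕ => x.1 • (1 : ℝ≥0) + x.2 • g).IsPWO := by
    rw [← Set.image_univ]
    refine Set.IsPWO.image_of_monotone (Set.isPWO_of_wellQuasiOrderedLE _) ?_
    rintro ⟨a, b⟩ ⟨a', b'⟩ ⟨h, h'⟩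
    simp only at h h' ⊢
    gcongr
  have hsub : F '' {a | Q a} ⊆ Set.range fun x : ℕ × ℕ => x.1 • (1 : ℝ≥0) + x.2 • g := by
    rintro _ ⟨a, ha, rfl⟩
    obtain ⟨n, k, h⟩ := (AddSubmonoid.mem_closure_pair _ _ _).1 (hF a ha)
    exact ⟨(n, k), h⟩
  have hwf := (hpwo.mono hsub).isWF
  obtain ⟨a, ha⟩ := hne
  have hne' : (F '' {a | Q a}).Nonempty := ⟨_, a, ha, rfl⟩
  obtain ⟨a₀, h₀, h₁⟩ := hwf.min_mem hne'
  exact ⟨a₀, h₀, fun b hb => h₁ ▸ hwf.min_le hne' ⟨b, hb, rfl⟩⟩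

theorem one_mem_costLattice (g : ℝ≥0) : 1 ∈ costLattice g :=
  AddSubmonoid.subset_closure (by simp)

theorem self_mem_costLattice (g : ℝ≥0) : g ∈ costLattice g :=
  AddSubmonoid.subset_closure (by simp)

theorem max_mem_costLattice {g x y : ℝ≥0} (hx : x ∈ costLattice g) (hy : y ∈ costLattice g) :
    max x y ∈ costLattice g := by
  rcases max_choice x y with h | h <;> rw [h] <;> assumption

theorem sup_mem_costLattice {g : ℝ≥0} {ι : Type*} (s : Finset ι) (f : ι → ℝ≥0)
    (h : ∀ i, f i ∈ costLattice g) : s.sup f ∈ costLattice g :=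
  Finset.sup_induction (p := (· ∈ costLattice g)) (zero_mem _)
    (fun _ hx _ hy => max_mem_costLattice hx hy) fun i _ => h i

/-- All compute and memory weights are `1`, and synchronization is free. -/
structure UnitWeights {V : Type} (G : CompDAG V) (A : Arch) : Prop where
  ω : ∀ v, G.ω v = 1
  μ : ∀ v, G.μ v = 1
  L : A.L = 0

variable {V : Type} {P : ℕ} {G : CompDAG V} {A : Arch}

theorem UnitWeights.opCost_mem (h : UnitWeights G A) (o : Op V) :
    o.cost G A ∈ costLattice A.g := by
  cases o <;> simp [Op.cost, h.ω, h.μ, one_mem_costLattice, self_mem_costLattice, zero_mem]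

theorem UnitWeights.seqCost_mem (h : UnitWeights G A) (l : List (Op V)) :
    seqCost G A l ∈ costLattice A.g := by
  refine AddSubmonoid.list_sum_mem _ fun x hx => ?_
  obtain ⟨o, -, rfl⟩ := List.mem_map.1 hx
  exact h.opCost_mem o

theorem UnitWeights.bspCost_mem [Fintype V] (h : UnitWeights G A) (X : BSPVariant)
    (σ : BSPSchedule V P) : σ.cost X G A ∈ costLattice A.g := by
  refine sum_mem fun s _ => ?_
  rw [h.L, add_zero]
  refine add_mem (sup_mem_costLattice _ _ fun p => ?_) ?_
  · exact sum_mem fun v _ => by rw [h.ω]; exact one_mem_costLattice _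
  -- Membership in the lattice would not suffice here: the `h`-relation is multiplied by `g`, and
  -- the lattice need not contain `g * g`. It has to be a natural number.
  · have : ∃ k : ℕ, (Finset.univ.sup fun p => max (σ.sent X G p s) (σ.received G p s)) = k := by
      refine Finset.sup_induction (p := fun x : ℝ≥0 => ∃ k : ℕ, x = k) ⟨0, by simp⟩
        (fun x hx y hy => ?_) (fun p _ => ?_)
      · rcases max_choice x y with h | h <;> rw [h] <;> assumption
      · rcases max_choice (σ.sent X G p s) (σ.received G p s) with h' | h' <;> rw [h'] <;>
          simp [BSPSchedule.sent, BSPSchedule.received, h.μ]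
    obtain ⟨k, hk⟩ := this
    rw [hk, mul_comm, ← nsmul_eq_mul]
    exact nsmul_mem (self_mem_costLattice _) k

theorem UnitWeights.syncCost_mem (h : UnitWeights G A) (S : Schedule V P) :
    syncCost G A S ∈ costLattice A.g := by
  refine AddSubmonoid.list_sum_mem _ fun x hx => ?_
  obtain ⟨Ψ, -, rfl⟩ := List.mem_map.1 hx
  unfold Superstep.cost
  rw [h.L, add_zero]
  refine add_mem (add_mem ?_ ?_) ?_ <;>
    exact sup_mem_costLattice _ _ fun p => h.seqCost_mem _

theorem UnitWeights.loadTime_mem (h : UnitWeights G A) (Γ : V → WithTop ℝ≥0) (l : List V)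
    (t : ℝ≥0) (ht : t ∈ costLattice A.g) (hΓ : ∀ v, (Γ v).untopD 0 ∈ costLattice A.g) :
    loadTime G A Γ t l ∈ costLattice A.g := by
  induction l generalizing t with
  | nil => exact ht
  | cons v l ih => exact ih _ (add_mem (max_mem_costLattice ht (hΓ v)) (h.opCost_mem _))

variable [DecidableEq V]

theorem UnitWeights.saveTime_mem (h : UnitWeights G A) (v : V) (l : List V) (t : ℝ≥0)
    (ht : t ∈ costLattice A.g) : (saveTime G A v t l).untopD 0 ∈ costLattice A.g := by
  induction l generalizing t with
  | nil => simp [saveTime, zero_mem]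
  | cons w l ih =>
    have := add_mem ht (h.opCost_mem (Op.save w))
    unfold saveTime
    split
    · rwa [WithTop.untopD_coe]
    · exact ih _ this

theorem UnitWeights.tick_mem (h : UnitWeights G A) (Ψ : Superstep V P) (k : Clock V P)
    (ht : ∀ p, k.time p ∈ costLattice A.g) (ha : ∀ v, (k.avail v).untopD 0 ∈ costLattice A.g) :
    (∀ p, (Ψ.tick G A k).time p ∈ costLattice A.g) ∧
      ∀ v, ((Ψ.tick G A k).avail v).untopD 0 ∈ costLattice A.g := by
  have hav : ∀ v, (Ψ.newAvail G A k v).untopD 0 ∈ costLattice A.g := by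
    intro v
    unfold Superstep.newAvail
    split
    · refine Finset.inf_induction (p := fun x : WithTop ℝ≥0 => x.untopD 0 ∈ costLattice A.g)
        (by simp [zero_mem]) (fun x hx y hy => ?_) (fun p _ => ?_)
      · rcases min_choice x y with h | h <;> rw [h] <;> assumption
      · exact h.saveTime_mem v _ _ (add_mem (ht p) (h.seqCost_mem _))
    · exact ha v
  exact ⟨fun p => h.loadTime_mem _ _ _
    (add_mem (add_mem (ht p) (h.seqCost_mem _)) (h.seqCost_mem _)) hav, hav⟩

theorem UnitWeights.asyncCost_mem (h : UnitWeights G A) (S : Schedule V P) :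
    asyncCost G A S ∈ costLattice A.g := by
  have key : ∀ (S : Schedule V P) (k : Clock V P), (∀ p, k.time p ∈ costLattice A.g) →
      (∀ v, (k.avail v).untopD 0 ∈ costLattice A.g) → ∀ p,
      (S.foldl (fun k Ψ => Superstep.tick G A Ψ k) k).time p ∈ costLattice A.g := by
    intro S
    induction S with
    | nil => intro k ht _ p; exact ht p
    | cons Ψ S ih =>
      intro k ht ha p
      obtain ⟨h1, h2⟩ := h.tick_mem Ψ k ht ha
      exact ih _ h1 h2 p
  refine sup_mem_costLattice _ _ fun p => key S _ (fun p => zero_mem _) (fun v => ?_) p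
  simp only [startClock]
  split <;> simp [zero_mem]

theorem UnitWeights.cost_mem (h : UnitWeights G A) (M : CostModel) (S : Schedule V P) :
    cost M G A S ∈ costLattice A.g := by
  cases M
  exacts [h.syncCost_mem S, h.asyncCost_mem S]

end Minima

/-! ### Reduction of supersteps to single rules -/

section Sequentialization
variable {V : Type} {P : ℕ} {G : CompDAG V} {A : Arch} {Q : Fin P → V → Prop}

theorem Op.Allowed.mono {o : Op V} {s : State V} {b : Finset V} (h : o.Allowed G s)
    (hb : s.blue ⊆ b) : o.Allowed G ⟨s.red, b⟩ := by
  cases o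
  exacts [hb h, h, h, h]

theorem seqCost_delete (l : List V) : seqCost G A (l.map .delete) = 0 := by
  simp [seqCost, Function.comp_def, Op.cost]

variable [DecidableEq V]

/-- The configuration after processor `p` applies the rule `o`, with the blue pebbles visible to all
processors at once. -/
def Config.apply (c : Config V P) (p : Fin P) (o : Op V) : Config V P :=
  ⟨Function.update c.red p (o.apply ⟨c.red p, c.blue⟩).red, (o.apply ⟨c.red p, c.blue⟩).blue⟩

/-- `Steps G A Q c x c'`: single rules of total cost `x`, applied by one processor after the other,
lead from `c` to `c'`; processor `p` computes `v` only if `Q p v`. -/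
inductive Steps (G : CompDAG V) (A : Arch) (Q : Fin P → V → Prop) :
    Config V P → ℝ≥0 → Config V P → Prop
  | refl (c : Config V P) : Steps G A Q c 0 c
  | head (c : Config V P) (p : Fin P) (o : Op V) (x : ℝ≥0) (c' : Config V P)
      (hr : ∑ v ∈ c.red p, G.μ v ≤ A.r) (ho : o.Allowed G ⟨c.red p, c.blue⟩)
      (hQ : ∀ v, o = .compute v → Q p v)
      (hr' : ∑ v ∈ (o.apply ⟨c.red p, c.blue⟩).red, G.μ v ≤ A.r)
      (h : Steps G A Q (c.apply p o) x c') : Steps G A Q c (o.cost G A + x) c'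

theorem Steps.trans {c₁ c₂ c₃ : Config V P} {x y : ℝ≥0} (h : Steps G A Q c₁ x c₂)
    (h' : Steps G A Q c₂ y c₃) : Steps G A Q c₁ (x + y) c₃ := by
  induction h with
  | refl c => simpa using h'
  | head c p o x c' hr ho hQ hr' _ ih =>
    rw [add_assoc]
    exact .head c p o _ _ hr ho hQ hr' (ih h')

theorem ValidSeq.memory {s : State V} {l : List (Op V)} (h : ValidSeq G A s l) :
    ∑ v ∈ s.red, G.μ v ≤ A.r := by
  cases l
  exacts [h, h.1]

theorem Op.apply_of_subset (o : Op V) (s : State V) (b : Finset V) (hb : s.blue ⊆ b) :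
    o.apply ⟨s.red, b⟩ = ⟨(o.apply s).red, b ∪ (o.apply s).blue⟩ := by
  cases o <;> simp [Op.apply, Finset.union_eq_left.2 hb]

theorem Op.blue_subset_apply (o : Op V) (s : State V) : s.blue ⊆ (o.apply s).blue := by
  cases o <;> simp [Op.apply]

theorem blue_subset_run (s : State V) (l : List (Op V)) : s.blue ⊆ (run s l).blue := by
  induction l generalizing s with
  | nil => exact subset_rfl
  | cons o l ih => exact (o.blue_subset_apply s).trans (ih _)

/-- When the processors act one after the other, a later one may see blue pebbles that it could not
see in the parallel phase. More blue pebbles never block a rule nor alter its effect on the red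
ones, so an inclusion of the blue sets suffices. -/
theorem ValidSeq.steps {s : State V} {l : List (Op V)} (h : ValidSeq G A s l)
    {c : Config V P} {p : Fin P} (hred : c.red p = s.red) (hblue : s.blue ⊆ c.blue)
    (hQ : ∀ v, Op.compute v ∈ l → Q p v) :
    Steps G A Q c (seqCost G A l)
      ⟨Function.update c.red p (run s l).red, c.blue ∪ (run s l).blue⟩ := by
  induction l generalizing s c with
  | nil =>
    have : (⟨Function.update c.red p (run s []).red, c.blue ∪ (run s []).blue⟩ : Config V P) = c := by
      simp [run, ← hred, Finset.union_eq_left.2 hblue]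
    rw [this]
    exact .refl c
  | cons o l ih =>
    obtain ⟨h1, h2, h3⟩ := h
    have happ := o.apply_of_subset s c.blue hblue
    rw [seqCost_cons]
    refine .head c p o _ _ (hred ▸ h1) (hred ▸ h2.mono hblue)
      (fun v hv => hQ v (by simp [hv])) ?_ ?_
    · rw [hred, happ]
      exact h3.memory
    · have h := ih (c := c.apply p o) h3 (by simp [Config.apply, hred, happ])
        (by simp [Config.apply, hred, happ]) (fun v hv => hQ v (by simp [hv]))
      have hsub := blue_subset_run (o.apply s) l
      convert h using 2
      · simp [Config.apply, run]
      · simp only [Config.apply, run, hred, happ, Finset.union_assoc,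
          Finset.union_eq_right.2 hsub]

theorem steps_phase (c : Config V P) (s : Fin P → State V) (l : Fin P → List (Op V))
    (hs : ∀ p, s p = ⟨c.red p, c.blue⟩) (h : ∀ p, ValidSeq G A (s p) (l p))
    (hQ : ∀ p v, Op.compute v ∈ l p → Q p v) (I : Finset (Fin P)) :
    Steps G A Q c (∑ p ∈ I, seqCost G A (l p))
      ⟨fun p => if p ∈ I then (run (s p) (l p)).red else c.red p,
        c.blue ∪ I.biUnion fun p => (run (s p) (l p)).blue⟩ := by
  induction I using Finset.induction_on with
  | empty => simpa using Steps.refl c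
  | insert p I hp ih =>
    rw [Finset.sum_insert hp, add_comm]
    refine ih.trans ?_
    have := (h p).steps (Q := Q) (p := p)
      (c := ⟨fun p => if p ∈ I then (run (s p) (l p)).red else c.red p,
        c.blue ∪ I.biUnion fun p => (run (s p) (l p)).blue⟩) (by simp [hp, hs])
      (by simp [hs]) (hQ p)
    convert this using 2
    · funext q
      by_cases hq : q = p
      · subst hq; simp
      · simp [hq]
    · ext v; simp only [Finset.mem_union, Finset.mem_biUnion, Finset.mem_insert]; aesop

theorem steps_phase_univ [Nonempty (Fin P)] (c : Config V P) (s : Fin P → State V)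
    (l : Fin P → List (Op V)) (hs : ∀ p, s p = ⟨c.red p, c.blue⟩)
    (h : ∀ p, ValidSeq G A (s p) (l p)) (hQ : ∀ p v, Op.compute v ∈ l p → Q p v) :
    Steps G A Q c (∑ p, seqCost G A (l p))
      ⟨fun p => (run (s p) (l p)).red, Finset.univ.biUnion fun p => (run (s p) (l p)).blue⟩ := by
  have := steps_phase c s l hs h hQ Finset.univ
  simp only [Finset.mem_univ, if_true] at this
  rwa [Finset.union_eq_right.2] at this
  obtain ⟨p⟩ := ‹Nonempty (Fin P)›
  refine subset_trans ?_ (Finset.subset_biUnion_of_mem _ (Finset.mem_univ p))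
  refine subset_trans ?_ (blue_subset_run _ _)
  rw [hs]

theorem run_blue_eq {s : State V} {l : List (Op V)} (h : ∀ v, Op.save v ∉ l) :
    (run s l).blue = s.blue := by
  induction l generalizing s with
  | nil => rfl
  | cons o l ih =>
    rw [run, ih fun v hv => h v (by simp [hv])]
    cases o
    case save v => exact absurd (by simp) (h v)
    all_goals rfl

theorem biUnion_univ_const [Nonempty (Fin P)] (b : Finset V) :
    (Finset.univ.biUnion fun _ : Fin P => b) = b := by
  ext; simp

/-- Each of the four phases is run processor by processor. Only saves change blue pebbles, so
outside the save phase all processors share one blue set and their states glue to a configuration.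
Sequentializing is a relaxation, which is all that lower bounds need. -/
theorem Superstep.Valid.steps [Nonempty (Fin P)] {Ψ : Superstep V P} {c : Config V P}
    (h : Ψ.Valid G A c) (hQ : ∀ p v, Op.compute v ∈ (Ψ p).comp → Q p v) :
    Steps G A Q c (∑ p, (Ψ p).cost G A) (Ψ.next c) := by
  have hblue : ∀ p, (Ψ.afterComp c p).blue = c.blue := fun p => by
    refine run_blue_eq fun v hv => ?_
    obtain ⟨w, hw⟩ := (Ψ p).comp_rules _ hv
    simp at hw
  have h1 := steps_phase_univ c _ (fun p => (Ψ p).comp) (fun p => rfl) (fun p => (h p).1) hQ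
  have e1 : (Finset.univ.biUnion fun p => (run ⟨c.red p, c.blue⟩ (Ψ p).comp).blue) = c.blue := by
    exact (Finset.biUnion_congr rfl fun p _ => hblue p).trans (biUnion_univ_const _)
  rw [e1] at h1
  have h2 := steps_phase_univ (Q := Q) ⟨fun p => (Ψ.afterComp c p).red, c.blue⟩
    (Ψ.afterComp c) (fun p => (Ψ p).save.map .save)
    (fun p => by rw [← hblue p]) (fun p => (h p).2.1) (by simp)
  have h3 := steps_phase_univ (Q := Q) ⟨fun p => (Ψ.afterSave c p).red, Ψ.newBlue c⟩
    (Ψ.synced c) (fun p => (Ψ p).del.map .delete) (fun p => rfl) (fun p => (h p).2.2.1) (by simp)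
  have hblue3 : ∀ p, (Ψ.afterDel c p).blue = Ψ.newBlue c := fun p => run_blue_eq (by simp)
  have e3 : (Finset.univ.biUnion fun p => (run (Ψ.synced c p) ((Ψ p).del.map .delete)).blue) =
      Ψ.newBlue c := by
    exact (Finset.biUnion_congr rfl fun p _ => hblue3 p).trans (biUnion_univ_const _)
  rw [e3] at h3
  have h4 := steps_phase_univ (Q := Q) ⟨fun p => (Ψ.afterDel c p).red, Ψ.newBlue c⟩
    (Ψ.afterDel c) (fun p => (Ψ p).load.map .load) (fun p => by rw [← hblue3 p])
    (fun p => (h p).2.2.2) (by simp)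
  have e4 : (Finset.univ.biUnion fun p => (run (Ψ.afterDel c p) ((Ψ p).load.map .load)).blue) =
      Ψ.newBlue c := by
    exact (Finset.biUnion_congr rfl fun p _ => (run_blue_eq (by simp)).trans (hblue3 p)).trans (biUnion_univ_const _)
  rw [e4] at h4
  have := ((h1.trans h2).trans h3).trans h4
  simp only [seqCost_delete, Finset.sum_const_zero, add_zero, ← Finset.sum_add_distrib] at this
  exact this

theorem ValidFrom.steps [Nonempty (Fin P)] {c : Config V P} {S : Schedule V P}
    (h : ValidFrom G A c S)
    (hQ : ∀ Ψ ∈ S, ∀ p v, Op.compute v ∈ (Ψ p).comp → Q p v) :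
    ∃ c', Steps G A Q c (totalCost G A S) c' ∧ ∀ v, G.IsSink v → v ∈ c'.blue := by
  induction S generalizing c with
  | nil => exact ⟨c, .refl c, h⟩
  | cons Ψ S ih =>
    obtain ⟨c', h1, h2⟩ := ih h.2 fun Ψ hΨ => hQ Ψ (by simp [hΨ])
    exact ⟨c', (h.1.steps (hQ Ψ (by simp))).trans h1, h2⟩

/-! ### The potential argument along a chain -/

/-- Only the first `f` nodes of the chain `N` have pebbles. -/
def PebbledBelow {m : ℕ} (N : Fin m → V) (f : ℕ) (c : Config V P) : Prop :=
  ∀ i, ((∃ p, N i ∈ c.red p) ∨ N i ∈ c.blue) → i.val < f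

/-- A potential argument along a chain `N`: every rule pays for the increase of the credit, and the
rule that computes node `i` of the chain additionally pays `a i`. -/
theorem Steps.sum_le_cost_add_credit {m : ℕ} {N : Fin m → V}
    (hN : Function.Injective N) (hedge : ∀ i j : Fin m, j.val = i.val + 1 → G.edge (N i) (N j))
    (a : ℕ → ℝ≥0) (credit : ℕ → Config V P → ℝ≥0)
    (hstay : ∀ f c p o, o.Allowed G ⟨c.red p, c.blue⟩ →
      credit f (c.apply p o) ≤ credit f c + o.cost G A)
    (hup : ∀ (i : Fin m) c p, Op.Allowed G (.compute (N i)) ⟨c.red p, c.blue⟩ → Q p (N i) →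
      ∑ v ∈ insert (N i) (c.red p), G.μ v ≤ A.r →
      a i + credit (i + 1) (c.apply p (.compute (N i))) ≤ credit i c + G.ω (N i))
    {c c' : Config V P} {x : ℝ≥0} (h : Steps G A Q c x c') (hend : ∀ i : Fin m, i.val + 1 = m → N i ∈ c'.blue)
    (f : ℕ) (hf : PebbledBelow N f c) :
    ∑ i ∈ Finset.Ico f m, a i ≤ x + credit f c := by
  induction h generalizing f with
  | refl c =>
    rw [Finset.Ico_eq_empty_of_le]
    · simp
    -- At the end the last node of the chain is blue, so the frontier has reached `m` and nothing
    -- remains to be paid for.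
    · by_contra! hlt
      have := hf ⟨m - 1, by omega⟩ (.inr (hend _ (by simp; omega)))
      simp at this
      omega
  | head c p o x c' hr ho hQ hr' _ ih =>
    -- The frontier `f` advances only when node `f` is computed for the first time. Every other
    -- rule, including a recomputation of an earlier node, keeps `PebbledBelow N f` and falls under
    -- `hstay`.
    by_cases hcase : ∃ i : Fin m, i.val = f ∧ o = .compute (N i)
    · obtain ⟨i, rfl, rfl⟩ := hcase
      have hnext : PebbledBelow N (i + 1) (c.apply p (.compute (N i))) := by
        intro j hj
        by_cases hji : j = i
        · subst hji; exact Nat.lt_succ_self _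
        · have hne : N j ≠ N i := fun h => hji (hN h)
          refine (hf j ?_).trans (Nat.lt_succ_self _)
          rcases hj with ⟨q, hq⟩ | hj
          · left
            by_cases hqp : q = p
            · subst hqp
              exact ⟨q, by simpa [Config.apply, Op.apply, hne] using hq⟩
            · exact ⟨q, by simpa [Config.apply, Op.apply, hqp] using hq⟩
          · exact .inr hj
      have h1 := ih hend (i + 1) hnext
      have h2 := hup i c p ho (hQ _ rfl) hr'
      rw [Finset.sum_eq_sum_Ico_succ_bot i.isLt]
      calc a i + ∑ k ∈ Finset.Ico (i.val + 1) m, a k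
          ≤ a i + (x + credit (i + 1) (c.apply p (.compute (N i)))) := by gcongr
        _ = x + (a i + credit (i + 1) (c.apply p (.compute (N i)))) := by ring
        _ ≤ x + (credit i c + G.ω (N i)) := by gcongr
        _ = G.ω (N i) + x + credit i c := by ring
    · have hnext : PebbledBelow N f (c.apply p o) := by
        intro j hj
        cases o with
        | compute v =>
          by_cases hv : N j = v
          -- Computing node `j` requires a red pebble on node `j - 1`, which lies below the
          -- frontier.
          · have hjf : j.val ≤ f := by
              by_contra! hlt
              have hlast : (⟨j.val - 1, by omega⟩ : Fin m).val < f := by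
                refine hf _ (.inl ⟨p, ho.2 _ ?_⟩)
                rw [← hv]
                exact hedge _ _ (by simp; omega)
              simp at hlast
              omega
            exact lt_of_le_of_ne hjf fun h => hcase ⟨j, h, by rw [hv]⟩
          · refine hf j ?_
            rcases hj with ⟨q, hq⟩ | hj
            · left
              by_cases hqp : q = p
              · subst hqp
                exact ⟨q, by simpa [Config.apply, Op.apply, hv] using hq⟩
              · exact ⟨q, by simpa [Config.apply, Op.apply, hqp] using hq⟩
            · exact .inr hj
        | load v =>
          refine hf j ?_
          rcases hj with ⟨q, hq⟩ | hj
          · by_cases hqp : q = p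
            · subst hqp
              simp only [Config.apply, Op.apply, Function.update_self, Finset.mem_insert] at hq
              rcases hq with rfl | hq
              exacts [.inr ho, .inl ⟨q, hq⟩]
            · exact .inl ⟨q, by simpa [Config.apply, Op.apply, hqp] using hq⟩
          · exact .inr hj
        | save v =>
          refine hf j ?_
          rcases hj with ⟨q, hq⟩ | hj
          · by_cases hqp : q = p
            · subst hqp
              exact .inl ⟨q, by simpa [Config.apply, Op.apply] using hq⟩
            · exact .inl ⟨q, by simpa [Config.apply, Op.apply, hqp] using hq⟩
          · simp only [Config.apply, Op.apply, Finset.mem_insert] at hj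
            rcases hj with rfl | hj
            exacts [.inl ⟨p, ho⟩, .inr hj]
        | delete v =>
          refine hf j ?_
          rcases hj with ⟨q, hq⟩ | hj
          · by_cases hqp : q = p
            · subst hqp
              exact .inl ⟨q, by
                simp only [Config.apply, Op.apply, Function.update_self] at hq
                exact Finset.mem_of_mem_erase hq⟩
            · exact .inl ⟨q, by simpa [Config.apply, Op.apply, hqp] using hq⟩
          · exact .inr hj
      have h1 := ih hend f hnext
      have h2 := hstay f c p o ho
      calc ∑ i ∈ Finset.Ico f m, a i ≤ x + credit f (c.apply p o) := h1
        _ ≤ x + (credit f c + o.cost G A) := by gcongr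
        _ = o.cost G A + x + credit f c := by ring

end Sequentialization

/-! ### Schedules that compute one node at a time -/

section Construction
variable {V : Type} {P : ℕ} {G : CompDAG V} {A : Arch}

/-- A superstep in which nothing but loads happen. -/
def loadStep (l : Fin P → List V) : Superstep V P := fun p => ⟨[], by simp, [], [], l p⟩

/-- A superstep in which processor `p` computes `x`, saves it, and deletes the nodes of `D`. -/
def fireStep (p : Fin P) (x : V) (D : List V) : Superstep V P := fun q =>
  if q = p then ⟨[.compute x], by simp, [x], D, []⟩ else ⟨[], by simp, [], [], []⟩

theorem sum_cost_loadStep (l : Fin P → List V) (hμ : ∀ v, G.μ v = 1) :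
    ∑ p, (loadStep l p).cost G A = ∑ p, ((l p).length : ℝ≥0) * A.g := by
  simp [loadStep, ProcStep.cost, seqCost, Function.comp_def, Op.cost, hμ]

theorem sum_cost_fireStep (p : Fin P) (x : V) (D : List V) (hμ : ∀ v, G.μ v = 1)
    (hω : ∀ v, G.ω v = 1) : ∑ q, (fireStep p x D q).cost G A = 1 + A.g := by
  rw [Finset.sum_eq_single p]
  · simp [fireStep, ProcStep.cost, seqCost, Op.cost, hμ, hω]
  · intro q _ hq
    simp [fireStep, ProcStep.cost, seqCost, hq]
  · simp

variable [DecidableEq V]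

theorem run_map_load (s : State V) (l : List V) :
    run s (l.map .load) = ⟨s.red ∪ l.toFinset, s.blue⟩ := by
  induction l generalizing s with
  | nil => simp [run]
  | cons v l ih => simp [run, ih, Op.apply]

theorem run_map_delete (s : State V) (l : List V) :
    run s (l.map .delete) = ⟨s.red \ l.toFinset, s.blue⟩ := by
  induction l generalizing s with
  | nil => simp [run]
  | cons v l ih =>
    simp only [List.map_cons, run, ih, Op.apply, State.mk.injEq, and_true]
    ext; simp; tauto

theorem validSeq_map_load {s : State V} {l : List V} (hl : ∀ v ∈ l, v ∈ s.blue)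
    (hr : ∑ v ∈ s.red ∪ l.toFinset, G.μ v ≤ A.r) : ValidSeq G A s (l.map .load) := by
  induction l generalizing s with
  | nil => simpa [ValidSeq] using hr
  | cons v l ih =>
    refine ⟨(Finset.sum_le_sum_of_subset Finset.subset_union_left).trans hr, hl v (by simp), ?_⟩
    refine ih (fun w hw => hl w (by simp [hw])) ?_
    simpa [Op.apply] using hr

theorem validSeq_map_delete {s : State V} {l : List V} (hn : l.Nodup) (hl : ∀ v ∈ l, v ∈ s.red)
    (hr : ∑ v ∈ s.red, G.μ v ≤ A.r) : ValidSeq G A s (l.map .delete) := by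
  induction l generalizing s with
  | nil => exact hr
  | cons v l ih =>
    rw [List.nodup_cons] at hn
    refine ⟨hr, hl v (by simp), ih hn.2 (fun w hw => ?_)
      ((Finset.sum_le_sum_of_subset (Finset.erase_subset _ _)).trans hr)⟩
    exact Finset.mem_erase.2 ⟨fun h => hn.1 (h ▸ hw), hl w (by simp [hw])⟩

theorem validFrom_loadStep_cons [Nonempty (Fin P)] {R R' : Fin P → Finset V} {b : Finset V}
    {l : Fin P → List V} {S : Schedule V P} (hl : ∀ p, ∀ v ∈ l p, v ∈ b)
    (hr : ∀ p, ∑ v ∈ R' p, G.μ v ≤ A.r) (hR' : ∀ p, R' p = R p ∪ (l p).toFinset)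
    (hS : ValidFrom G A ⟨R', b⟩ S) : ValidFrom G A ⟨R, b⟩ (loadStep l :: S) := by
  have hmem : ∀ p, ∑ v ∈ R p, G.μ v ≤ A.r := fun p =>
    (Finset.sum_le_sum_of_subset (by rw [hR']; exact Finset.subset_union_left)).trans (hr p)
  have hblue : (loadStep l).newBlue ⟨R, b⟩ = b := biUnion_univ_const b
  have hdel : ∀ p, (loadStep l).afterDel ⟨R, b⟩ p = ⟨R p, b⟩ := by
    intro p
    change (⟨R p, (loadStep l).newBlue ⟨R, b⟩⟩ : State V) = _
    rw [hblue]
  have hnext : (loadStep l).next ⟨R, b⟩ = ⟨R', b⟩ := by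
    simp only [Superstep.next, hblue, Config.mk.injEq, and_true]
    funext p
    rw [Superstep.afterLoad, hdel, run_map_load, hR']
    rfl
  refine ⟨fun p => ⟨hmem p, hmem p, hmem p, ?_⟩, by rwa [hnext]⟩
  rw [hdel]
  refine validSeq_map_load (hl p) ?_
  have := hr p
  rwa [hR'] at this

theorem validFrom_fireStep_cons [Nonempty (Fin P)] {R R' : Fin P → Finset V} {b : Finset V}
    {p : Fin P} {x : V} {D : List V} {S : Schedule V P} (hx : ¬ G.IsSource x)
    (hpar : ∀ u, G.edge u x → u ∈ R p) (hr : ∑ v ∈ insert x (R p), G.μ v ≤ A.r)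
    (hr' : ∀ q, q ≠ p → ∑ v ∈ R q, G.μ v ≤ A.r) (hD : D.Nodup)
    (hDR : ∀ v ∈ D, v ∈ insert x (R p)) (hp : R' p = insert x (R p) \ D.toFinset)
    (hq : ∀ q, q ≠ p → R' q = R q)
    (hS : ValidFrom G A ⟨R', insert x b⟩ S) : ValidFrom G A ⟨R, b⟩ (fireStep p x D :: S) := by
  have hsave : ∀ q, (fireStep p x D).afterSave ⟨R, b⟩ q =
      if q = p then ⟨insert x (R p), insert x b⟩ else ⟨R q, b⟩ := by
    intro q
    by_cases h : q = p
    · subst h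
      simp [Superstep.afterSave, Superstep.afterComp, fireStep, run, Op.apply]
    · simp [Superstep.afterSave, Superstep.afterComp, fireStep, run, h]
  have hblue : (fireStep p x D).newBlue ⟨R, b⟩ = insert x b := by
    ext v
    simp only [Superstep.newBlue, hsave, Finset.mem_biUnion, Finset.mem_univ, true_and]
    constructor
    · rintro ⟨q, hq⟩
      split at hq
      · exact hq
      · exact Finset.mem_insert_of_mem hq
    · exact fun h => ⟨p, by simpa using h⟩
  have hdel : ∀ q, (fireStep p x D).afterDel ⟨R, b⟩ q = ⟨R' q, insert x b⟩ := by
    intro q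
    rw [Superstep.afterDel, run_map_delete, Superstep.synced, hblue, hsave]
    by_cases h : q = p
    · subst h
      simp [fireStep, hp]
    · simp [fireStep, h, hq q h]
  have hnext : (fireStep p x D).next ⟨R, b⟩ = ⟨R', insert x b⟩ := by
    simp only [Superstep.next, hblue, Config.mk.injEq, and_true]
    funext q
    rw [Superstep.afterLoad, hdel]
    by_cases h : q = p <;> simp [fireStep, h, run]
  refine ⟨fun q => ?_, by rwa [hnext]⟩
  rw [hdel]
  by_cases h : q = p
  · subst h
    have hR : ∑ v ∈ R q, G.μ v ≤ A.r :=
      (Finset.sum_le_sum_of_subset (Finset.subset_insert _ _)).trans hr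
    have hR' : ∑ v ∈ R' q, G.μ v ≤ A.r :=
      (Finset.sum_le_sum_of_subset (by rw [hp]; exact Finset.sdiff_subset)).trans hr
    refine ⟨?_, ?_, ?_, ?_⟩
    · simpa [fireStep, ValidSeq, Op.Allowed, Op.apply] using ⟨hR, ⟨hx, hpar⟩, hr⟩
    · simpa [fireStep, ValidSeq, Op.Allowed, Op.apply, Superstep.afterComp, run] using hr
    · have : (fireStep q x D q).del = D := by simp [fireStep]
      rw [this, Superstep.synced, hsave]
      refine validSeq_map_delete hD ?_ ?_
      · simpa using hDR
      · simpa using hr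
    · simpa [fireStep, ValidSeq] using hR'
  · have h1 := hr' q h
    refine ⟨?_, ?_, ?_, ?_⟩
    · simpa [fireStep, ValidSeq, h] using h1
    · simpa [fireStep, ValidSeq, h, Superstep.afterComp, run] using h1
    · simpa [fireStep, ValidSeq, h, Superstep.synced, hsave] using h1
    · simpa [fireStep, ValidSeq, h, hq q h] using h1

variable [Fintype V]

open Classical in
/-- The parents of `x` outside of the set `R`. -/
noncomputable def missing (G : CompDAG V) (R : Finset V) (x : V) : Finset V :=
  (Finset.univ.filter fun u => G.edge u x) \ R

/-- Two supersteps in which processor `p` loads the parents of `x` outside of `R`, computes and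
saves `x`, and deletes these nodes again. -/
noncomputable def fire (G : CompDAG V) (R : Finset V) (p : Fin P) (x : V) : Schedule V P :=
  [loadStep fun q => if q = p then (missing G R x).toList else [],
    fireStep p x (insert x (missing G R x)).toList]

/-- Each processor `p` loads the set `R p`; then the nodes of `l` are computed one after the other,
node `x` on processor `π x`. -/
noncomputable def fireAll (G : CompDAG V) (R : Fin P → Finset V) (π : V → Fin P) (l : List V) :
    Schedule V P :=
  loadStep (fun p => (R p).toList) :: l.flatMap fun x => fire G (R (π x)) (π x) x

theorem totalCost_flatMap_fire_le (hG : UnitWeights G A) (R : Fin P → Finset V) (π : V → Fin P)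
    (l : List V) (k : ℕ) (hk : ∀ x ∈ l, (missing G (R (π x)) x).card ≤ k) :
    totalCost G A (l.flatMap fun x => fire G (R (π x)) (π x) x) ≤
      l.length * (k * A.g + (1 + A.g)) := by
  induction l with
  | nil => simp [totalCost]
  | cons x l ih =>
    have h1 := ih fun y hy => hk y (by simp [hy])
    have h2 : ((missing G (R (π x)) x).card : ℝ≥0) ≤ k := by exact_mod_cast hk x (by simp)
    unfold totalCost at h1 ⊢
    simp only [List.flatMap_cons, fire, List.cons_append, List.map_cons, List.sum_cons,
      List.nil_append, sum_cost_loadStep _ hG.μ, sum_cost_fireStep _ _ _ hG.μ hG.ω,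
      apply_ite List.length, Finset.length_toList, List.length_nil, Nat.cast_ite, ite_mul,
      Finset.sum_ite_eq', Finset.mem_univ, if_true, List.length_cons, Nat.cast_add, Nat.cast_one,
      Nat.cast_zero, zero_mul]
    simp only [fire] at h1
    rw [← add_assoc, add_mul, one_mul, add_comm]
    gcongr

theorem totalCost_fireAll_le (hG : UnitWeights G A) (R : Fin P → Finset V) (π : V → Fin P)
    (l : List V) (k : ℕ) (hk : ∀ x ∈ l, (missing G (R (π x)) x).card ≤ k) :
    totalCost G A (fireAll G R π l) ≤
      ∑ p, ((R p).card : ℝ≥0) * A.g + l.length * (k * A.g + (1 + A.g)) := by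
  have := totalCost_flatMap_fire_le hG R π l k hk
  unfold totalCost at this ⊢
  rw [fireAll, List.map_cons, List.sum_cons, sum_cost_loadStep _ hG.μ]
  simp only [Finset.length_toList]
  gcongr

/-- The memory bound holds when node `x` is computed with the set `R p` kept in the memory of each
processor `p`. -/
structure HomeSets (G : CompDAG V) (A : Arch) (R : Fin P → Finset V) (π : V → Fin P) : Prop where
  source : ∀ p, ∀ v ∈ R p, G.IsSource v
  home : ∀ p, ∑ v ∈ R p, G.μ v ≤ A.r
  memory : ∀ x, ¬ G.IsSource x →
    ∑ v ∈ insert x (R (π x) ∪ missing G (R (π x)) x), G.μ v ≤ A.r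

/-- Every node is saved as soon as it is computed, and everything outside the home sets is deleted
again. Between two nodes the memories are thus exactly `R`, and all earlier nodes can be loaded from
slow memory by any processor. -/
theorem HomeSets.validFrom_flatMap_fire [Nonempty (Fin P)] {R : Fin P → Finset V} {π : V → Fin P}
    (h : HomeSets G A R π) (κ : V → ℕ) (hκ : ∀ u v, ¬ G.IsSource u → G.edge u v → κ u < κ v)
    (l : List V) (hl : l.Pairwise fun x y => κ x ≤ κ y) (hs : ∀ x ∈ l, ¬ G.IsSource x)
    (b : Finset V) (hpar : ∀ x ∈ l, ∀ u, G.edge u x → u ∈ b ∨ (¬ G.IsSource u ∧ u ∈ l))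
    (hend : ∀ v, v ∈ b ∨ v ∈ l) :
    ValidFrom G A ⟨R, b⟩ (l.flatMap fun x => fire G (R (π x)) (π x) x) := by
  induction l generalizing b with
  | nil => exact fun v _ => (hend v).resolve_right (by simp)
  | cons x l ih =>
    rw [List.pairwise_cons] at hl
    have hx := hs x (by simp)
    have hxR : x ∉ R (π x) := fun hmem => hx (h.source _ _ hmem)
    have hxm : ∀ v ∈ missing G (R (π x)) x, v ∈ b := by
      intro u hu
      simp only [missing, Finset.mem_sdiff, Finset.mem_filter, Finset.mem_univ, true_and] at hu
      -- A non-source parent still in the list would have a key at least that of `x`, against `hκ`.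
      refine (hpar x (by simp) u hu.1).resolve_right fun ⟨hus, hul⟩ => ?_
      have hlt := hκ u x hus hu.1
      rcases List.mem_cons.1 hul with rfl | hul
      · exact lt_irrefl _ hlt
      · exact absurd (hl.1 u hul) (by omega)
    have hrest : ValidFrom G A ⟨R, insert x b⟩ (l.flatMap fun x => fire G (R (π x)) (π x) x) := by
      refine ih hl.2 (fun y hy => hs y (by simp [hy])) _ (fun y hy u hu => ?_) (fun v => ?_)
      · rcases hpar y (by simp [hy]) u hu with h | ⟨h, h'⟩
        · exact .inl (by simp [h])
        · rcases List.mem_cons.1 h' with rfl | h'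
          exacts [.inl (by simp), .inr ⟨h, h'⟩]
      · rcases hend v with h | h
        · exact .inl (by simp [h])
        · rcases List.mem_cons.1 h with rfl | h
          exacts [.inl (by simp), .inr h]
    have hmem := h.memory x hx
    rw [List.flatMap_cons]
    refine validFrom_loadStep_cons
      (R' := Function.update R (π x) (R (π x) ∪ missing G (R (π x)) x)) ?_ ?_ ?_ ?_
    · intro p v hv
      split at hv
      · exact hxm v (by simpa using hv)
      · simp at hv
    · intro p
      by_cases hp : p = π x
      · subst hp
        rw [Function.update_self]
        exact (Finset.sum_le_sum_of_subset (Finset.subset_insert _ _)).trans hmem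
      · rw [Function.update_of_ne hp]
        exact h.home p
    · intro p
      by_cases hp : p = π x
      · subst hp; simp
      · simp [hp]
    · refine validFrom_fireStep_cons (R' := R) hx ?_ ?_ ?_ (Finset.nodup_toList _) ?_ ?_ ?_ hrest
      · intro u hu
        by_cases huR : u ∈ R (π x) <;> simp [missing, hu, huR]
      · simpa using hmem
      · intro q hq
        rw [Function.update_of_ne hq]
        exact h.home q
      · intro v hv
        simp only [Finset.mem_toList, Finset.mem_insert] at hv
        rw [Function.update_self]
        rcases hv with rfl | hv <;> simp [*]
      · rw [Function.update_self, Finset.toList_toFinset]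
        ext v
        -- The deletion must restore `R` exactly: the loaded parents are disjoint from `R` by
        -- definition, and `x` is not in `R` because home sets consist of sources.
        have : v ∈ missing G (R (π x)) x → v ∉ R (π x) := fun hv =>
          (Finset.mem_sdiff.1 hv).2
        have h' : v = x → v ∉ R (π x) := fun h => h ▸ hxR
        simp only [Finset.mem_sdiff, Finset.mem_insert, Finset.mem_union]
        tauto
      · intro q hq
        rw [Function.update_of_ne hq]

theorem HomeSets.isSchedule_fireAll [Nonempty (Fin P)] {R : Fin P → Finset V} {π : V → Fin P}
    (h : HomeSets G A R π) (κ : V → ℕ) (hκ : ∀ u v, ¬ G.IsSource u → G.edge u v → κ u < κ v)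
    (l : List V) (hl : l.Pairwise fun x y => κ x ≤ κ y) (hs : ∀ x, x ∈ l ↔ ¬ G.IsSource x) :
    IsSchedule G A (fireAll G R π l) := by
  refine validFrom_loadStep_cons (R' := R) (fun p v hv => ?_) h.home (by simp) ?_
  · simpa using h.source p v (by simpa using hv)
  · refine h.validFrom_flatMap_fire κ hκ l hl (fun x => (hs x).1) _ (fun x _ u _ => ?_) fun v => ?_
    · simp only [hs, Finset.mem_filter, Finset.mem_univ, true_and]; tauto
    · simp only [hs, Finset.mem_filter, Finset.mem_univ, true_and]; tauto

omit [DecidableEq V] in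
open Classical in
/-- The non-source nodes can be listed by increasing key. -/
theorem exists_sorted_nonsources (G : CompDAG V) (κ : V → ℕ) :
    ∃ l : List V, l.Nodup ∧ (l.Pairwise fun x y => κ x ≤ κ y) ∧ (∀ x, x ∈ l ↔ ¬ G.IsSource x) ∧
      l.length ≤ Fintype.card V := by
  let l := (Finset.univ.filter fun x => ¬ G.IsSource x).toList
  have hp := List.mergeSort_perm l fun x y => decide (κ x ≤ κ y)
  refine ⟨l.mergeSort fun x y => decide (κ x ≤ κ y), hp.nodup_iff.2 (Finset.nodup_toList _), ?_,
    fun x => ?_, ?_⟩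
  · have := List.pairwise_mergeSort (le := fun x y => decide (κ x ≤ κ y))
      (fun a b c h h' => by simp at h h' ⊢; omega) (fun a b => by simp; omega) l
    simpa using this
  · simp [hp.mem_iff, l]
  · rw [hp.length_eq, Finset.length_toList]
    exact Finset.card_le_univ _

theorem computeSeq_flatMap_fire (R : Fin P → Finset V) (π : V → Fin P) (l : List V) (p : Fin P) :
    computeSeq (l.flatMap fun x => fire G (R (π x)) (π x) x) p = l.filter (π · = p) := by
  induction l with
  | nil => rfl
  | cons x l ih =>
    unfold computeSeq at ih ⊢
    rw [List.flatMap_cons, List.flatMap_append, ih, List.filter_cons]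
    by_cases h : π x = p
    · simp [fire, loadStep, fireStep, h, Op.computed?]
    · simp [fire, loadStep, fireStep, h, Ne.symm h]

/-- The supersteps of `S` are those of `σ` from superstep `s` on, each of them split. -/
def SplitsFrom (σ : BSPSchedule V P) (s : ℕ) (S : Schedule V P) : Prop :=
  ∃ f : ℕ → ℕ, Monotone f ∧ (∀ k, s ≤ f k) ∧
    ∀ (k : ℕ) (hk : k < S.length) (p : Fin P) (v : V),
      Op.compute v ∈ (S[k] p).comp → σ.proc v = p ∧ σ.step v = f k

omit [DecidableEq V] [Fintype V] in
theorem SplitsFrom.cons {σ : BSPSchedule V P} {s t : ℕ} {S : Schedule V P} {Ψ : Superstep V P}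
    (h : SplitsFrom σ t S) (hst : s ≤ t)
    (hΨ : ∀ p v, Op.compute v ∈ (Ψ p).comp → σ.proc v = p ∧ σ.step v = t) :
    SplitsFrom σ s (Ψ :: S) := by
  obtain ⟨f, hf, hs, hS⟩ := h
  -- The new first superstep belongs to superstep `t` of `σ`; the bound `t ≤ f k` for the remaining
  -- ones gives monotonicity.
  refine ⟨fun k => k.casesOn t f, monotone_nat_of_le_succ fun k => ?_, fun k => ?_, ?_⟩
  · cases k with
    | zero => exact hs 0
    | succ k => exact hf (Nat.le_succ k)
  · cases k with
    | zero => exact hst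
    | succ k => exact hst.trans (hs k)
  · intro k hk p v hv
    cases k with
    | zero => exact hΨ p v hv
    | succ k => exact hS k (by simpa using hk) p v hv

theorem splitsFrom_flatMap_fire (σ : BSPSchedule V P) (R : Fin P → Finset V) (l : List V)
    (hl : l.Pairwise fun x y => σ.step x ≤ σ.step y) (s : ℕ) (hs : ∀ x ∈ l, s ≤ σ.step x) :
    SplitsFrom σ s (l.flatMap fun x => fire G (R (σ.proc x)) (σ.proc x) x) := by
  induction l generalizing s with
  | nil => exact ⟨fun _ => s, monotone_const, fun _ => le_rfl, by simp⟩
  | cons x l ih =>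
    rw [List.pairwise_cons] at hl
    rw [List.flatMap_cons]
    refine ((ih hl.2 (σ.step x) hl.1).cons le_rfl (Ψ := fireStep _ _ _) ?_).cons
      (hs x (by simp)) (Ψ := loadStep _) (by simp [loadStep])
    intro p v hv
    by_cases hp : p = σ.proc x
    · simp only [fireStep, hp, if_true, List.mem_singleton, Op.compute.injEq] at hv
      simp [hv, hp]
    · simp [fireStep, hp] at hv

theorem refines_fireAll (σ : BSPSchedule V P) (R : Fin P → Finset V) (l : List V) (hn : l.Nodup)
    (hl : l.Pairwise fun x y => σ.step x ≤ σ.step y) (hs : ∀ x, x ∈ l ↔ ¬ G.IsSource x) :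
    Refines G σ (fireAll G R σ.proc l) := by
  constructor
  · intro v hv
    have := computeSeq_flatMap_fire (G := G) R σ.proc l (σ.proc v)
    unfold computeSeq at this ⊢
    rw [fireAll, List.flatMap_cons, this]
    simp only [loadStep, List.filterMap_nil, List.nil_append]
    exact List.count_eq_one_of_mem (hn.filter _) (by simp [hs, hv])
  · obtain ⟨f, hf, -, h⟩ := (splitsFrom_flatMap_fire (G := G) σ R l hl 0 (by simp)).cons le_rfl
      (Ψ := loadStep fun p => (R p).toList) (by simp [loadStep])
    exact ⟨f, hf, h⟩

end Construction

/-! ### Memory needs of the zipper DAG and the two upper bounds -/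

section Zipper
variable {P d m : ℕ}

theorem unitWeights_zipper (P d m : ℕ) (g : ℝ≥0) : UnitWeights (zipper P d m) (zipperArch d g) :=
  ⟨fun _ => rfl, fun _ => rfl, rfl⟩

/-- The processor `n % 2`. -/
def alternate (hP : 2 ≤ P) (n : ℕ) : Fin P := ⟨n % 2, by omega⟩

/-- The processor that holds all source parents of a node in its group. -/
def zipperHome (hP : 2 ≤ P) : ZipperNode P d m → Fin P
  | (k, .inl _) => k
  | (k, .inr i) => if 2 ≤ k.val then k else alternate hP (k.val + i.val)

/-- The `k`-th group of sources. -/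
def group (d m : ℕ) (k : Fin P) : Finset (ZipperNode P d m) :=
  Finset.univ.image fun j => (k, .inl j)

theorem mem_group {k : Fin P} {v : ZipperNode P d m} :
    v ∈ group d m k ↔ ∃ j, (k, .inl j) = v := by
  simp [group]

theorem card_group (k : Fin P) : (group d m k).card = d := by
  rw [group, Finset.card_image_of_injective _ fun a b h => by simpa using h]
  simp

/-- The chain parent of a chain node. -/
def chainParent : ZipperNode P d m → Finset (ZipperNode P d m)
  | (_, .inl _) => ∅
  | (k, .inr i) => (Finset.univ.filter fun i' : Fin m => i.val = i'.val + 1).image fun i' => (k, .inr i')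

theorem card_chainParent_le (v : ZipperNode P d m) : (chainParent v).card ≤ 1 := by
  rcases v with ⟨k, j | i⟩
  · simp [chainParent]
  · refine Finset.card_image_le.trans (Finset.card_le_one.2 fun a ha b hb => ?_)
    simp only [Finset.mem_filter, Finset.mem_univ, true_and] at ha hb
    exact Fin.ext (by omega)

theorem isSource_inl (k : Fin P) (j : Fin d) : (zipper P d m).IsSource (k, .inl j) := by
  intro u h
  have := zipperRank_lt h
  simp [zipperRank] at this

theorem source_edge (hP : 2 ≤ P) (k : Fin P) (i : Fin m) (j : Fin d) :
    (zipper P d m).edge (zipperHome hP ((k, .inr i) : ZipperNode P d m), .inl j) (k, .inr i) := by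
  by_cases hk : 2 ≤ k.val
  · simp only [zipperHome, if_pos hk]
    exact .own k j i (.inl hk)
  · simp only [zipperHome, if_neg hk]
    rcases Nat.mod_two_eq_zero_or_one i.val with hi | hi
    · have : alternate hP (k.val + i.val) = k := Fin.ext (by simp [alternate]; omega)
      rw [this]
      exact .own k j i (.inr hi)
    · refine .cross k _ j i (by omega) (by simp [alternate]; omega) (fun h => ?_) hi
      have := congrArg Fin.val h
      simp [alternate] at this
      omega

/-- Nonempty groups matter here: for `d = 0` the first node of each chain would be a source as well.
-/
theorem isSource_iff (hP : 2 ≤ P) (hd : 1 ≤ d) (v : ZipperNode P d m) :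
    (zipper P d m).IsSource v ↔ v.2.isLeft := by
  rcases v with ⟨k, j | i⟩
  · simp [isSource_inl]
  · simp only [Sum.isLeft_inr, Bool.false_eq_true, iff_false]
    exact fun h => h _ (source_edge hP k i ⟨0, hd⟩)

theorem mem_of_edge (hP : 2 ≤ P) {u v : ZipperNode P d m} (h : (zipper P d m).edge u v) :
    u ∈ group d m (zipperHome hP v) ∪ chainParent v := by
  rw [Finset.mem_union, mem_group]
  change ZipperEdge P d m u v at h
  cases h with
  | chain k i i' h =>
    right
    simpa [chainParent] using h
  | own k j i h =>
    left
    refine ⟨j, ?_⟩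
    rw [Prod.mk.injEq]
    refine ⟨?_, rfl⟩
    by_cases hk : 2 ≤ k.val
    · simp [zipperHome, hk]
    · simp only [zipperHome, if_neg hk]
      exact Fin.ext (by simp [alternate]; omega)
  | cross k k' j i hk hk' hne h =>
    left
    refine ⟨j, ?_⟩
    rw [Prod.mk.injEq]
    refine ⟨?_, rfl⟩
    simp only [zipperHome, if_neg (show ¬ 2 ≤ k.val by omega)]
    have : k.val ≠ k'.val := fun h => hne (Fin.ext h)
    exact Fin.ext (by simp [alternate]; omega)

theorem missing_subset (hP : 2 ≤ P) (R : Finset (ZipperNode P d m)) (v : ZipperNode P d m) :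
    missing (zipper P d m) R v ⊆ (group d m (zipperHome hP v) ∪ chainParent v) \ R := by
  refine Finset.sdiff_subset_sdiff (fun u hu => ?_) subset_rfl
  exact mem_of_edge hP (by simpa using hu)

/-- All source parents of `v` lie in a single group. Together with at most one chain parent and `v`
itself this makes at most `d + 2` nodes. -/
theorem memory_le (hP : 2 ≤ P) (g : ℝ≥0) (R : Finset (ZipperNode P d m)) (v : ZipperNode P d m)
    (hR : R ⊆ group d m (zipperHome hP v)) :
    ∑ u ∈ insert v (R ∪ missing (zipper P d m) R v), (zipper P d m).μ u ≤ (zipperArch d g).r := by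
  have hsub : insert v (R ∪ missing (zipper P d m) R v) ⊆
      insert v (group d m (zipperHome hP v) ∪ chainParent v) := by
    refine Finset.insert_subset_insert _ (Finset.union_subset
      (hR.trans Finset.subset_union_left) ?_)
    exact (missing_subset hP R v).trans Finset.sdiff_subset
  have hcard : (insert v (R ∪ missing (zipper P d m) R v)).card ≤ d + 2 := by
    refine (Finset.card_le_card hsub).trans ((Finset.card_insert_le _ _).trans ?_)
    have := Finset.card_union_le (group d m (zipperHome hP v)) (chainParent v)
    have := card_chainParent_le v
    have := card_group (d := d) (m := m) (zipperHome hP v)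
    omega
  simp only [zipper, zipperArch, Finset.sum_const, nsmul_eq_mul, mul_one]
  exact_mod_cast hcard

theorem homeSets_empty (hP : 2 ≤ P) (g : ℝ≥0) (π : ZipperNode P d m → Fin P) :
    HomeSets (zipper P d m) (zipperArch d g) (fun _ => ∅) π where
  source := by simp
  home := by simp
  memory v _ := memory_le hP g ∅ v (by simp)

theorem homeSets_group (hP : 2 ≤ P) (g : ℝ≥0) :
    HomeSets (zipper P d m) (zipperArch d g) (group d m) (zipperHome hP) where
  source p v hv := by
    obtain ⟨j, rfl⟩ := mem_group.1 hv
    exact isSource_inl p j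
  home p := by
    simp [zipper, zipperArch, card_group]
  memory v _ := memory_le hP g _ v subset_rfl

/-- A schedule of linear cost that keeps each group of sources on one processor. -/
theorem exists_schedule_linear_cost (hP : 2 ≤ P) (g : ℝ≥0) :
    ∃ S : Schedule (ZipperNode P d m) P, IsSchedule (zipper P d m) (zipperArch d g) S ∧
      totalCost (zipper P d m) (zipperArch d g) S ≤
        P * (d * g) + Fintype.card (ZipperNode P d m) * (g + (1 + g)) := by
  have : Nonempty (Fin P) := ⟨⟨0, by omega⟩⟩
  obtain ⟨l, -, hl, hs, hlen⟩ := exists_sorted_nonsources (zipper P d m) zipperRank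
  refine ⟨fireAll (zipper P d m) (group d m) (zipperHome hP) l,
    (homeSets_group hP g).isSchedule_fireAll zipperRank (fun u v _ h => zipperRank_lt h) l hl hs, ?_⟩
  -- The home processor already holds the whole group, so at most the chain parent has to be loaded.
  refine (totalCost_fireAll_le (unitWeights_zipper P d m g) _ _ l 1 fun v _ => ?_).trans ?_
  · refine le_trans (Finset.card_le_card ((missing_subset hP _ v).trans ?_)) (card_chainParent_le v)
    intro u
    simp only [Finset.mem_sdiff, Finset.mem_union]
    tauto
  · simp only [card_group, zipperArch, Finset.sum_const, Finset.card_univ, Fintype.card_fin,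
      nsmul_eq_mul, Nat.cast_one, one_mul]
    gcongr

/-- Every valid BSP schedule has a refinement of quadratic cost. -/
theorem exists_refinement_quadratic_cost (hP : 2 ≤ P) (g : ℝ≥0) {X : BSPVariant}
    {σ : BSPSchedule (ZipperNode P d m) P} (hσ : σ.Valid X (zipper P d m)) :
    ∃ S : Schedule (ZipperNode P d m) P, IsSchedule (zipper P d m) (zipperArch d g) S ∧
      Refines (zipper P d m) σ S ∧ totalCost (zipper P d m) (zipperArch d g) S ≤
        Fintype.card (ZipperNode P d m) * (((d + 1 : ℕ) : ℝ≥0) * g + (1 + g)) := by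
  have : Nonempty (Fin P) := ⟨⟨0, by omega⟩⟩
  -- As ranks are at most `m`, this encodes the lexicographic order by superstep and rank: sorting
  -- by it respects both the supersteps of `σ` and the edges.
  let κ : ZipperNode P d m → ℕ := fun v => σ.step v * (m + 1) + zipperRank v
  have hrank : ∀ v : ZipperNode P d m, zipperRank v < m + 1 := by
    rintro ⟨k, j | i⟩ <;> simp [zipperRank]
  obtain ⟨l, hn, hl, hs, hlen⟩ := exists_sorted_nonsources (zipper P d m) κ
  have hstep : ∀ u v, ¬ (zipper P d m).IsSource u → (zipper P d m).edge u v →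
      σ.step u ≤ σ.step v := by
    intro u v hu huv
    have hX : X.Computes (zipper P d m) u := by
      cases X
      exacts [trivial, hu]
    rcases hσ.edge u v huv with ⟨-, -, h⟩ | ⟨s, hs, hc⟩
    · exact h
    · exact (hσ.comm_computed _ _ _ hc hX).trans hs.le
  refine ⟨fireAll (zipper P d m) (fun _ => ∅) σ.proc l,
    (homeSets_empty hP g σ.proc).isSchedule_fireAll κ (fun u v hu h => ?_) l hl hs,
    refines_fireAll σ _ l hn (hl.imp fun {u v} h => ?_) hs, ?_⟩
  · have h1 := zipperRank_lt h
    have h2 := Nat.mul_le_mul_right (m + 1) (hstep u v hu h)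
    simp only [κ]
    omega
  · by_contra! hlt
    have h1 := Nat.mul_le_mul_right (m + 1) hlt
    have := hrank v
    simp only [κ, Nat.succ_mul] at h h1
    omega
  · refine (totalCost_fireAll_le (unitWeights_zipper P d m g) _ _ l (d + 1) fun v _ => ?_).trans ?_
    · refine (Finset.card_le_card ((missing_subset hP _ v).trans Finset.sdiff_subset)).trans ?_
      have := Finset.card_union_le (group d m (zipperHome hP v)) (chainParent v)
      have := card_chainParent_le v
      have := card_group (d := d) (m := m) (zipperHome hP v)
      omega
    · simp only [zipperArch, Finset.card_empty, Nat.cast_zero, zero_mul, Finset.sum_const_zero,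
        zero_add]
      gcongr

/-! ### Lower bounds along the first chain -/

/-- The nodes of the first chain, with indices modulo `m`. -/
def pathNode (hP : 2 ≤ P) [NeZero m] (n : ℕ) : ZipperNode P d m :=
  (alternate hP 0, .inr (Fin.ofNat m n))

theorem pathNode_val (hP : 2 ≤ P) [NeZero m] (i : Fin m) :
    (pathNode hP i.val : ZipperNode P d m) = (alternate hP 0, .inr i) := by
  simp [pathNode]

theorem pathNode_source_edge (hP : 2 ≤ P) [NeZero m] (i : Fin m) (j : Fin d) :
    (zipper P d m).edge (alternate hP i, .inl j) (pathNode hP i.val) := by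
  have := source_edge hP (alternate hP 0) i j
  simpa [pathNode_val, zipperHome, alternate] using this

theorem pathNode_edge (hP : 2 ≤ P) [NeZero m] (n : ℕ) (hn : n + 1 < m) :
    (zipper P d m).edge (pathNode hP n) (pathNode hP (n + 1)) := by
  refine .chain _ _ _ ?_
  simp [Nat.mod_eq_of_lt hn, Nat.mod_eq_of_lt (show n < m by omega)]

theorem pathNode_injective (hP : 2 ≤ P) [NeZero m] :
    Function.Injective fun i : Fin m => (pathNode hP i.val : ZipperNode P d m) := by
  intro a b h
  simpa [pathNode_val] using h

theorem isSink_pathNode (hP : 2 ≤ P) [NeZero m] (i : Fin m) (hi : i.val + 1 = m) :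
    (zipper P d m).IsSink (pathNode hP i.val) := by
  intro w h
  rw [pathNode_val] at h
  change ZipperEdge P d m _ _ at h
  cases h with
  | chain _ _ i' h => exact absurd i'.isLt (by omega)

theorem pebbledBelow_initial (hP : 2 ≤ P) (hd : 1 ≤ d) [NeZero m] :
    PebbledBelow (fun i : Fin m => pathNode hP i.val) 0 (initial (zipper P d m) P) := by
  rintro i (⟨p, h⟩ | h)
  · simp [initial] at h
  · simp [initial, isSource_iff hP hd, pathNode] at h

/-- Every node of the first chain has to be computed. -/
theorem le_totalCost (hP : 2 ≤ P) (hd : 1 ≤ d) [NeZero m] (g : ℝ≥0)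
    {S : Schedule (ZipperNode P d m) P} (hS : IsSchedule (zipper P d m) (zipperArch d g) S) :
    (m : ℝ≥0) ≤ totalCost (zipper P d m) (zipperArch d g) S := by
  have : Nonempty (Fin P) := ⟨⟨0, by omega⟩⟩
  obtain ⟨c', h, hend⟩ := ValidFrom.steps (Q := fun _ _ => True) hS (by simp)
  -- No credit is needed: each first computation of a chain node pays `1` by its own compute weight.
  have := h.sum_le_cost_add_credit (pathNode_injective hP)
    (fun i j hij => by rw [hij]; exact pathNode_edge hP _ (hij ▸ j.isLt)) (fun _ => 1)
    (fun _ _ => 0) (by simp) (by simp [zipper])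
    (fun i hi => hend _ (isSink_pathNode hP i hi)) 0 (pebbledBelow_initial hP hd)
  simpa using this

/-- Sources cannot be computed, so they enter a memory only through loads, one for each payment of
`g`. This is the condition `hstay` for the credit used below. -/
theorem card_group_inter_apply_le (g : ℝ≥0) (k q p : Fin P) (c : Config (ZipperNode P d m) P)
    (o : Op (ZipperNode P d m)) (ho : o.Allowed (zipper P d m) ⟨c.red p, c.blue⟩) :
    ((group d m k ∩ (c.apply p o).red q).card : ℝ≥0) * g ≤
      (group d m k ∩ c.red q).card * g + o.cost (zipper P d m) (zipperArch d g) := by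
  by_cases hq : q = p
  · subst hq
    cases o with
    | load v =>
      have : (group d m k ∩ insert v (c.red q)).card ≤ (group d m k ∩ c.red q).card + 1 := by
        refine (Finset.card_le_card (t := insert v (group d m k ∩ c.red q)) fun u => ?_).trans
          (Finset.card_insert_le _ _)
        simp only [Finset.mem_inter, Finset.mem_insert]
        tauto
      simp only [Config.apply, Op.apply, Function.update_self, Op.cost, zipper, zipperArch, one_mul]
      calc _ ≤ (((group d m k ∩ c.red q).card + 1 : ℕ) : ℝ≥0) * g := by gcongr
        _ = _ := by push_cast; ring
    | save v => simp [Config.apply, Op.apply]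
    | compute v =>
      refine le_trans (le_of_eq ?_) le_self_add
      have hv : v ∉ group d m k := fun hv => by
        obtain ⟨j, rfl⟩ := mem_group.1 hv
        exact ho.1 (isSource_inl k j)
      simp [Config.apply, Op.apply, Finset.inter_insert_of_notMem hv]
    | delete v =>
      refine le_trans ?_ le_self_add
      simp only [Config.apply, Op.apply, Function.update_self]
      gcongr
      exact Finset.erase_subset _ _
  · simp [Config.apply, hq]

/-- If processor `p` computes two consecutive nodes of the first chain, then it loads a whole group
of sources in between. -/
theorem switches_le_totalCost (hP : 2 ≤ P) (hd : 1 ≤ d) [NeZero m] (g : ℝ≥0)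
    (π : ZipperNode P d m → Fin P) {S : Schedule (ZipperNode P d m) P}
    (hS : IsSchedule (zipper P d m) (zipperArch d g) S)
    (hπ : ∀ Ψ ∈ S, ∀ p v, Op.compute v ∈ (Ψ p).comp → π v = p) :
    (((Finset.Ico 2 m).filter fun i => π (pathNode hP i) = π (pathNode hP (i - 1))).card : ℝ≥0) *
      (d * g) ≤ totalCost (zipper P d m) (zipperArch d g) S := by
  have : Nonempty (Fin P) := ⟨⟨0, by omega⟩⟩
  obtain ⟨c', h, hend⟩ := ValidFrom.steps (Q := fun p v => π v = p) hS hπ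
  let a : ℕ → ℝ≥0 := fun i =>
    if 2 ≤ i ∧ π (pathNode hP i) = π (pathNode hP (i - 1)) then d * g else 0
  -- The credit counts the sources needed by the next node `f` that are already in the memory of the
  -- processor of node `f - 1`. It starts at `f = 2`, since node `0` has no chain parent: its
  -- computation leaves one slot free, which may hold a source of the other group.
  let credit : ℕ → Config (ZipperNode P d m) P → ℝ≥0 := fun f c =>
    if 2 ≤ f then (group d m (alternate hP f) ∩ c.red (π (pathNode hP (f - 1)))).card * g else 0
  have key := h.sum_le_cost_add_credit (pathNode_injective hP)
    (fun i j hij => by rw [hij]; exact pathNode_edge hP _ (hij ▸ j.isLt)) a credit ?_ ?_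
    (fun i hi => hend _ (isSink_pathNode hP i hi)) 0 (pebbledBelow_initial hP hd)
  · have hc : credit 0 (initial (zipper P d m) P) = 0 := by simp [credit]
    rw [hc, add_zero] at key
    refine le_trans (le_of_eq ?_) key
    rw [← Finset.sum_filter, Finset.sum_const, nsmul_eq_mul]
    congr 3
    ext i
    simp only [Finset.mem_filter, Finset.mem_Ico, zero_le, true_and]
    tauto
  · intro f c p o ho
    by_cases hf : 2 ≤ f
    · simpa only [credit, if_pos hf] using card_group_inter_apply_le g _ _ p c o ho
    · simp [credit, hf]
  · intro i c p ho hp hr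
    have hgroup : group d m (alternate hP i) ⊆ c.red p := by
      intro v hv
      obtain ⟨j, rfl⟩ := mem_group.1 hv
      exact ho.2 _ (pathNode_source_edge hP i j)
    have hzero : credit (i.val + 1) (c.apply p (.compute (pathNode hP i.val))) = 0 := by
      by_cases hi : 1 ≤ i.val
      swap
      · simp [credit]; omega
      -- When node `i` is computed, its group, its chain parent and the node itself fill the memory.
      -- A source of the other group would be node number `d + 3`.
      have hempty : group d m (alternate hP (i.val + 1)) ∩
          insert (pathNode hP i.val) (c.red p) = ∅ := by
        by_contra hne
        obtain ⟨w, hw⟩ := Finset.nonempty_iff_ne_empty.2 hne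
        obtain ⟨hw1, hw2⟩ := Finset.mem_inter.1 hw
        obtain ⟨j, rfl⟩ := mem_group.1 hw1
        have hprev : (pathNode hP (i.val - 1) : ZipperNode P d m) ∈ c.red p := by
          refine ho.2 _ ?_
          have := pathNode_edge (d := d) (m := m) hP (i.val - 1) (by omega)
          rwa [Nat.sub_add_cancel hi] at this
        have hne : (pathNode hP (i.val - 1) : ZipperNode P d m) ≠ pathNode hP i.val := by
          intro h
          have := @pathNode_injective P d m hP _ ⟨i.val - 1, by omega⟩ i h
          simp [Fin.ext_iff] at this
          omega
        have hsub : insert (alternate hP (i.val + 1), .inl j) (insert (pathNode hP (i.val - 1))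
            (insert (pathNode hP i.val) (group d m (alternate hP i)))) ⊆
            insert (pathNode hP i.val) (c.red p) := by
          refine Finset.insert_subset hw2 (Finset.insert_subset (Finset.mem_insert_of_mem hprev) ?_)
          exact Finset.insert_subset_insert _ hgroup
        have hcard := Finset.card_le_card hsub
        rw [Finset.card_insert_of_notMem, Finset.card_insert_of_notMem,
          Finset.card_insert_of_notMem, card_group] at hcard
        · simp only [zipper, zipperArch, Finset.sum_const, nsmul_eq_mul, mul_one] at hr
          have : (insert (pathNode hP i.val) (c.red p)).card ≤ d + 2 := by exact_mod_cast hr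
          omega
        · simp [mem_group, pathNode]
        · simp only [Finset.mem_insert, not_or]
          exact ⟨hne, by simp [mem_group, pathNode]⟩
        · have : alternate hP i.val ≠ alternate hP (i.val + 1) := by
            intro h
            have := congrArg Fin.val h
            simp [alternate] at this
            omega
          simp [mem_group, pathNode, this]
      simp only [credit, Nat.add_sub_cancel]
      rw [hp]
      simp [Config.apply, Op.apply, hempty]
    rw [hzero, add_zero]
    refine le_trans ?_ le_self_add
    -- If the processor is the same as for the predecessor, the credit counts the full group in its
    -- memory and equals the required `d * g`.
    by_cases hi : 2 ≤ i.val ∧ π (pathNode hP i.val) = π (pathNode hP (i.val - 1))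
    · simp only [a, credit, if_pos hi, if_pos hi.1]
      rw [← hi.2, hp, Finset.inter_eq_left.2 hgroup, card_group]
    · simp [a, hi]

end Zipper

/-! ### Optimal BSP schedules rarely move the first chain -/

section FirstStage
variable {P d m : ℕ}

/-- The BSP schedule that broadcasts all sources and then computes chain `k` on processor `k`. -/
def chainSchedule (P d m : ℕ) : BSPSchedule (ZipperNode P d m) P where
  steps := 2
  proc v := v.1
  step v := if v.2.isLeft then 0 else 1
  comm := Finset.univ.image fun x : Fin P × Fin d × Fin P => ((x.1, .inl x.2.1), x.2.2, 0)

theorem chainSchedule_valid (hP : 2 ≤ P) (hd : 1 ≤ d) (X : BSPVariant) :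
    (chainSchedule P d m).Valid X (zipper P d m) where
  step_lt v _ := by simp only [chainSchedule]; split <;> simp
  comm_lt v q s h := by
    simp only [chainSchedule, Finset.mem_image, Prod.mk.injEq] at h
    obtain ⟨x, -, -, -, rfl⟩ := h
    simp [chainSchedule]
  comm_computed v q s h _ := by
    simp only [chainSchedule, Finset.mem_image, Prod.mk.injEq] at h
    obtain ⟨x, -, rfl, -, -⟩ := h
    simp [chainSchedule]
  edge u v h := by
    change ZipperEdge P d m u v at h
    cases h with
    | chain k i i' h =>
      refine .inl ⟨?_, rfl, le_rfl⟩
      cases X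
      · trivial
      · simp [BSPVariant.Computes, isSource_iff hP hd]
    | own k j i h => exact .inr ⟨0, by simp [chainSchedule], by simp [chainSchedule]⟩
    | cross k k' j i hk hk' hne h =>
      exact .inr ⟨0, by simp [chainSchedule], by simp [chainSchedule]⟩

/-- A processor computes at most `d` sources in superstep `0`, and sends and receives at most `P *
d` values there; superstep `1` contains one chain of `m` nodes per processor and no communication.
-/
theorem chainSchedule_cost_le (X : BSPVariant) (g : ℝ≥0) :
    (chainSchedule P d m).cost X (zipper P d m) (zipperArch d g) ≤ P * d * g + d + m := by
  classical
  have hwork0 : ∀ p, (chainSchedule P d m).work X (zipper P d m) p 0 ≤ d := by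
    intro p
    have : (Finset.univ.filter fun v => X.Computes (zipper P d m) v ∧
        (chainSchedule P d m).proc v = p ∧ (chainSchedule P d m).step v = 0) ⊆
        Finset.univ.image fun j : Fin d => (p, .inl j) := by
      rintro ⟨k, j | i⟩ h
      · have hk : k = p := (Finset.mem_filter.1 h).2.2.1
        simp [hk]
      · simp [chainSchedule] at h
    have := (Finset.card_le_card this).trans Finset.card_image_le
    simp only [BSPSchedule.work, zipper, Finset.sum_const, nsmul_eq_mul, mul_one]
    simp only [Finset.card_univ, Fintype.card_fin] at this
    exact_mod_cast this
  have hwork1 : ∀ p, (chainSchedule P d m).work X (zipper P d m) p 1 ≤ m := by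
    intro p
    have : (Finset.univ.filter fun v => X.Computes (zipper P d m) v ∧
        (chainSchedule P d m).proc v = p ∧ (chainSchedule P d m).step v = 1) ⊆
        Finset.univ.image fun i : Fin m => (p, .inr i) := by
      rintro ⟨k, j | i⟩ h
      · simp [chainSchedule] at h
      · have hk : k = p := (Finset.mem_filter.1 h).2.2.1
        simp [hk]
    have := (Finset.card_le_card this).trans Finset.card_image_le
    simp only [BSPSchedule.work, zipper, Finset.sum_const, nsmul_eq_mul, mul_one]
    simp only [Finset.card_univ, Fintype.card_fin] at this
    exact_mod_cast this
  have hsent0 : ∀ p, (chainSchedule P d m).sent X (zipper P d m) p 0 ≤ P * d := by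
    intro p
    have : ((chainSchedule P d m).comm.filter fun x => X.Computes (zipper P d m) x.1 ∧
        (chainSchedule P d m).proc x.1 = p ∧ x.2.2 = 0) ⊆
        Finset.univ.image fun x : Fin P × Fin d => ((p, .inl x.2), x.1, 0) := by
      rintro ⟨v, q, s⟩ h
      obtain ⟨hc, -, hp, hs⟩ := Finset.mem_filter.1 h
      simp only [chainSchedule, Finset.mem_image, Prod.mk.injEq] at hc
      obtain ⟨⟨k, j, q'⟩, -, rfl, rfl, -⟩ := hc
      have hk : k = p := hp
      have hs' : s = 0 := hs
      simp [hk, hs']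
    have := (Finset.card_le_card this).trans Finset.card_image_le
    simp only [BSPSchedule.sent, zipper, Finset.sum_const, nsmul_eq_mul, mul_one]
    simp only [Finset.card_univ, Fintype.card_prod, Fintype.card_fin] at this
    exact_mod_cast this
  have hrec0 : ∀ p, (chainSchedule P d m).received (zipper P d m) p 0 ≤ P * d := by
    intro p
    have : ((chainSchedule P d m).comm.filter fun x => x.2.1 = p ∧ x.2.2 = 0) ⊆
        Finset.univ.image fun x : Fin P × Fin d => ((x.1, .inl x.2), p, 0) := by
      rintro ⟨v, q, s⟩ h
      simp only [chainSchedule, Finset.mem_filter, Finset.mem_image, Prod.mk.injEq] at h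
      obtain ⟨⟨⟨k, j, q'⟩, -, rfl, rfl, -⟩, rfl, rfl⟩ := h
      simp
    have := (Finset.card_le_card this).trans Finset.card_image_le
    simp only [BSPSchedule.received, zipper, Finset.sum_const, nsmul_eq_mul, mul_one]
    simp only [Finset.card_univ, Fintype.card_prod, Fintype.card_fin] at this
    exact_mod_cast this
  have hstep : ∀ x ∈ (chainSchedule P d m).comm, x.2.2 = 0 := by
    rintro ⟨v, q, s⟩ h
    simp only [chainSchedule, Finset.mem_image, Prod.mk.injEq] at h
    obtain ⟨x, -, -, -, rfl⟩ := h
    rfl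
  have hsent1 : ∀ p, (chainSchedule P d m).sent X (zipper P d m) p 1 = 0 := by
    intro p
    rw [BSPSchedule.sent, Finset.filter_false_of_mem, Finset.sum_empty]
    intro x hx h
    have := hstep x hx
    omega
  have hrec1 : ∀ p, (chainSchedule P d m).received (zipper P d m) p 1 = 0 := by
    intro p
    rw [BSPSchedule.received, Finset.filter_false_of_mem, Finset.sum_empty]
    intro x hx h
    have := hstep x hx
    omega
  have hsteps : (chainSchedule P d m).steps = 2 := rfl
  rw [BSPSchedule.cost, hsteps, Finset.sum_range_succ, Finset.sum_range_one]
  simp only [hsent1, hrec1, max_self]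
  have h0 : (Finset.univ.sup fun p => (chainSchedule P d m).work X (zipper P d m) p 0) ≤ d :=
    Finset.sup_le fun p _ => hwork0 p
  have h1 : (Finset.univ.sup fun p => (chainSchedule P d m).work X (zipper P d m) p 1) ≤ m :=
    Finset.sup_le fun p _ => hwork1 p
  have h2 : (Finset.univ.sup fun p => max ((chainSchedule P d m).sent X (zipper P d m) p 0)
      ((chainSchedule P d m).received (zipper P d m) p 0)) ≤ P * d :=
    Finset.sup_le fun p _ => max_le (hsent0 p) (hrec0 p)
  have h3 : (Finset.univ.sup fun _ : Fin P => (0 : ℝ≥0)) ≤ 0 := Finset.sup_le fun _ _ => le_rfl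
  calc _ ≤ (d + g * (P * d) + 0) + (m + g * 0 + 0 : ℝ≥0) := by
        simp only [zipperArch]
        gcongr
    _ = _ := by ring

open Classical in
/-- The supersteps in which some value is communicated. -/
noncomputable def BSPSchedule.commSteps {V : Type} (σ : BSPSchedule V P) : Finset ℕ :=
  (Finset.range σ.steps).filter fun s => ∃ v q, (v, q, s) ∈ σ.comm

theorem BSPSchedule.mem_commSteps {V : Type} {σ : BSPSchedule V P} {s : ℕ} :
    s ∈ σ.commSteps ↔ s < σ.steps ∧ ∃ v q, (v, q, s) ∈ σ.comm := by
  simp [commSteps]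

/-- In a superstep with communication some processor receives at least one unit of data, so the
superstep costs at least `g`. -/
theorem BSPSchedule.card_commSteps_le {V : Type} [Fintype V] {G : CompDAG V} {A : Arch}
    (hG : UnitWeights G A) (X : BSPVariant) (σ : BSPSchedule V P) :
    (σ.commSteps.card : ℝ≥0) * A.g ≤ σ.cost X G A := by
  classical
  rw [BSPSchedule.cost, ← nsmul_eq_mul, ← Finset.sum_const]
  refine (Finset.sum_le_sum fun s hs => ?_).trans
    (Finset.sum_le_sum_of_subset fun s hs => Finset.mem_range.2 (mem_commSteps.1 hs).1)
  obtain ⟨-, v, q, hv⟩ := mem_commSteps.1 hs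
  have h1 : 1 ≤ σ.received G q s := by
    have := Finset.single_le_sum (f := fun x : V × Fin P × ℕ => G.μ x.1) (fun _ _ => zero_le)
      (Finset.mem_filter.2 ⟨hv, rfl, rfl⟩ :
        (v, q, s) ∈ σ.comm.filter fun x => x.2.1 = q ∧ x.2.2 = s)
    rw [hG.μ] at this
    simpa only [BSPSchedule.received] using this
  have h2 := (h1.trans (le_max_right (σ.sent X G q s) _)).trans (Finset.le_sup
    (f := fun p => max (σ.sent X G p s) (σ.received G p s)) (Finset.mem_univ q))
  calc A.g = 0 + A.g * 1 + 0 := by ring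
    _ ≤ _ := by gcongr <;> exact zero_le

/-- The first chain changes the processor at most once per superstep with communication. -/
theorem card_switches_le (hP : 2 ≤ P) (hd : 1 ≤ d) [NeZero m] {X : BSPVariant}
    {σ : BSPSchedule (ZipperNode P d m) P} (hσ : σ.Valid X (zipper P d m)) :
    ((Finset.Ico 2 m).filter fun i =>
      ¬ σ.proc (pathNode hP i) = σ.proc (pathNode hP (i - 1))).card ≤ σ.commSteps.card := by
  classical
  have hX : ∀ n, X.Computes (zipper P d m) (pathNode hP n) := by
    intro n
    cases X
    · trivial
    · simp [BSPVariant.Computes, isSource_iff hP hd, pathNode]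
  have hstep : ∀ n, n + 1 < m → σ.step (pathNode hP n) ≤ σ.step (pathNode hP (n + 1)) := by
    intro n hn
    rcases hσ.edge _ _ (pathNode_edge hP n hn) with ⟨-, -, h⟩ | ⟨s, hs, hc⟩
    · exact h
    · exact (hσ.comm_computed _ _ _ hc (hX n)).trans hs.le
  have hmono : ∀ i j, i ≤ j → j < m → σ.step (pathNode hP i) ≤ σ.step (pathNode hP j) := by
    intro i j hij
    induction j, hij using Nat.le_induction with
    | base => exact fun _ => le_rfl
    | succ j _ ih => exact fun h => (ih (by omega)).trans (hstep j h)
  -- A change of processor before node `i` forces a transfer of node `i - 1` in some superstep from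
  -- its own computation up to, but excluding, that of node `i`. Along the chain these intervals are
  -- disjoint, so the chosen supersteps increase strictly.
  have hex : ∀ i, ∃ s, i ∈ ((Finset.Ico 2 m).filter fun i =>
      ¬ σ.proc (pathNode hP i) = σ.proc (pathNode hP (i - 1))) →
      s ∈ σ.commSteps ∧ σ.step (pathNode hP (i - 1)) ≤ s ∧ s < σ.step (pathNode hP i) := by
    intro i
    by_cases hi : i ∈ ((Finset.Ico 2 m).filter fun i =>
      ¬ σ.proc (pathNode hP i) = σ.proc (pathNode hP (i - 1)))
    swap
    · exact ⟨0, fun h => absurd h hi⟩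
    obtain ⟨hi1, hi2⟩ := Finset.mem_filter.1 hi
    rw [Finset.mem_Ico] at hi1
    have hedge := pathNode_edge (d := d) (m := m) hP (i - 1) (by omega)
    rw [Nat.sub_add_cancel (by omega)] at hedge
    rcases hσ.edge _ _ hedge with ⟨-, h, -⟩ | ⟨s, hs, hc⟩
    · exact absurd h.symm hi2
    · exact ⟨s, fun _ => ⟨BSPSchedule.mem_commSteps.2 ⟨hσ.comm_lt _ _ _ hc, _, _, hc⟩,
        hσ.comm_computed _ _ _ hc (hX _), hs⟩⟩
  choose s hs using hex
  have hlt : ∀ i j, i < j → i ∈ ((Finset.Ico 2 m).filter fun i =>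
      ¬ σ.proc (pathNode hP i) = σ.proc (pathNode hP (i - 1))) →
      j ∈ ((Finset.Ico 2 m).filter fun i =>
      ¬ σ.proc (pathNode hP i) = σ.proc (pathNode hP (i - 1))) → s i < s j := by
    intro i j hij hi hj
    have hj' := Finset.mem_Ico.1 (Finset.mem_filter.1 hj).1
    exact ((hs i hi).2.2.trans_le (hmono i (j - 1) (by omega) (by omega))).trans_le (hs j hj).2.1
  refine Finset.card_le_card_of_injOn s (fun i hi => (hs i hi).1) fun i hi j hj h => ?_
  rcases lt_trichotomy i j with hij | hij | hij
  · exact absurd h (hlt i j hij hi hj).ne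
  · exact hij
  · exact absurd h (hlt j i hij hj hi).ne'

/-- In an optimal BSP schedule, the first chain stays on its processor for a quarter of the time. -/
theorem le_four_mul_card_stays (hP : 2 ≤ P) (hd : 1 ≤ d) [NeZero m] {X : BSPVariant} {g : ℝ≥0}
    (hg : 2 * (P : ℝ≥0) ≤ g) (hm : (P : ℝ≥0) * d * g + d < m)
    {σ : BSPSchedule (ZipperNode P d m) P}
    (hσ : σ.IsOptimal X (zipper P d m) (zipperArch d g)) :
    m ≤ 4 * ((Finset.Ico 2 m).filter fun i =>
      σ.proc (pathNode hP i) = σ.proc (pathNode hP (i - 1))).card := by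
  have hP' : (2 : ℝ≥0) ≤ P := by exact_mod_cast hP
  have hd' : (1 : ℝ≥0) ≤ d := by exact_mod_cast hd
  have hg' : (4 : ℝ≥0) ≤ g := by
    refine le_trans ?_ hg
    calc (4 : ℝ≥0) = 2 * 2 := by norm_num
      _ ≤ 2 * P := by gcongr
  -- With `s` changes, `4 * s < 2 * m`, there are `m - 2 - s` stays among the indices from `2` on;
  -- four times this number exceeds `2 * m - 8`, which is at least `m` once `m ≥ 8`.
  have hm9 : 9 < m := by
    have : (9 : ℝ≥0) < m := by
      refine lt_of_le_of_lt ?_ hm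
      calc (9 : ℝ≥0) = 2 * 1 * 4 + 1 := by norm_num
        _ ≤ _ := by gcongr
    exact_mod_cast this
  have hcost : σ.commSteps.card * 4 < 2 * m := by
    have h1 := σ.card_commSteps_le (unitWeights_zipper P d m g) X
    have h2 := (hσ.2 _ (chainSchedule_valid hP hd X)).trans (chainSchedule_cost_le X g)
    have : (σ.commSteps.card : ℝ≥0) * 4 < 2 * m := by
      calc (σ.commSteps.card : ℝ≥0) * 4 ≤ σ.commSteps.card * g := by gcongr
        _ ≤ P * d * g + d + m := h1.trans h2
        _ < m + m := by gcongr
        _ = 2 * m := by ring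
    exact_mod_cast this
  have hsw := card_switches_le hP hd hσ.1
  have hsum := Finset.card_filter_add_card_filter_not (s := Finset.Ico 2 m)
    fun i => σ.proc (pathNode hP i) = σ.proc (pathNode hP (i - 1))
  rw [Nat.card_Ico] at hsum
  omega

end FirstStage
end MBSP

/-! ### The main theorem -/

open MBSP
theorem theorem1 (P : ℕ) (hP : 2 ≤ P) (g : ℝ≥0) (hg : 2 * (P : ℝ≥0) ≤ g) (K : ℝ≥0) :
    ∃ c C : ℝ≥0, 0 < c ∧ 0 < C ∧
      ∀ d m : ℕ, 1 ≤ d → (P : ℝ≥0) * d * g + d < m → (m : ℝ≥0) ≤ K * d →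
      ∀ (X : BSPVariant) (M : CostModel),
        (∃ σ : BSPSchedule (ZipperNode P d m) P, σ.IsOptimal X (zipper P d m) (zipperArch d g)) ∧
        (∃ S : Schedule (ZipperNode P d m) P, IsOptimal M (zipper P d m) (zipperArch d g) S) ∧
        ∀ σ : BSPSchedule (ZipperNode P d m) P, σ.IsOptimal X (zipper P d m) (zipperArch d g) →
          (∃ T : Schedule (ZipperNode P d m) P,
            IsOptimalRefinement M (zipper P d m) (zipperArch d g) σ T) ∧
          ∀ T S : Schedule (ZipperNode P d m) P,
            IsOptimalRefinement M (zipper P d m) (zipperArch d g) σ T →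
            IsOptimal M (zipper P d m) (zipperArch d g) S →
              0 < cost M (zipper P d m) (zipperArch d g) S ∧
              c * Fintype.card (ZipperNode P d m) * cost M (zipper P d m) (zipperArch d g) S ≤
                cost M (zipper P d m) (zipperArch d g) T ∧
              cost M (zipper P d m) (zipperArch d g) T ≤
                C * Fintype.card (ZipperNode P d m) *
                  cost M (zipper P d m) (zipperArch d g) S := by
  have hP' : (2 : ℝ≥0) ≤ P := by exact_mod_cast hP
  have hPpos : (0 : ℝ≥0) < P := lt_of_lt_of_le (by norm_num) hP'
  have hg4 : (4 : ℝ≥0) ≤ g := by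
    refine le_trans ?_ hg
    calc (4 : ℝ≥0) = 2 * 2 := by norm_num
      _ ≤ 2 * P := by gcongr
  have hgpos : 0 < g := lt_of_lt_of_le (by norm_num) hg4
  -- For `c`: the outcome costs at least `m * d * g / (4 * P)`, the optimum at most `6 * P * m * g`,
  -- and `n ≤ 2 * P * m ≤ 2 * P * K * d`; the product of the constants is `48 * P ^ 3 * K`, and `K +
  -- 1` keeps it positive. For `C`: the outcome costs at most `4 * g * n * d`, and `d ≤ m ≤ P *
  -- OPT`.
  refine ⟨(48 * P ^ 3 * (K + 1))⁻¹, 4 * g * P, by positivity, by positivity, ?_⟩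
  intro d m hd hm hK X M
  have hd' : (1 : ℝ≥0) ≤ d := by exact_mod_cast hd
  have hdm : (d : ℝ≥0) ≤ m := le_add_self.trans hm.le
  have hmpos : (0 : ℝ≥0) < m := lt_of_lt_of_le (by positivity) hdm
  have : NeZero m := ⟨by rintro rfl; simp at hmpos⟩
  have hG := unitWeights_zipper P d m g
  have hcard : (Fintype.card (ZipperNode P d m) : ℝ≥0) = P * (d + m) := by simp
  refine ⟨?_, ?_, fun σ hσ => ⟨?_, fun T S hT hS => ?_⟩⟩
  · exact exists_minimal_of_mem_costLattice g _ _ (fun σ _ => hG.bspCost_mem X σ)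
      ⟨_, chainSchedule_valid hP hd X⟩
  · obtain ⟨S, hS, -⟩ := exists_schedule_linear_cost (d := d) (m := m) hP g
    exact exists_minimal_of_mem_costLattice g _ _ (fun S _ => hG.cost_mem M S) ⟨S, hS⟩
  · obtain ⟨T, hT, hT', -⟩ := exists_refinement_quadratic_cost hP g hσ.1
    obtain ⟨T₀, h, h'⟩ := exists_minimal_of_mem_costLattice g
      (fun T => IsSchedule (zipper P d m) (zipperArch d g) T ∧ Refines (zipper P d m) σ T)
      (cost M (zipper P d m) (zipperArch d g)) (fun T _ => hG.cost_mem M T) ⟨T, hT, hT'⟩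
    exact ⟨T₀, h.1, h.2, fun T' h1 h2 => h' T' ⟨h1, h2⟩⟩
  have hOPT := (le_totalCost hP hd g hS.1).trans (totalCost_le_mul_cost M _ _ S)
  refine ⟨?_, ?_, ?_⟩
  · exact pos_of_mul_pos_right (hmpos.trans_le hOPT) zero_le
  · have hlow : (m : ℝ≥0) * (d * g) ≤ 4 * P * cost M (zipper P d m) (zipperArch d g) T := by
      have h1 := switches_le_totalCost hP hd g σ.proc hT.1 fun Ψ hΨ p v hv => by
        obtain ⟨-, f, -, hf⟩ := hT.2.1
        obtain ⟨k, hk, rfl⟩ := List.getElem_of_mem hΨ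
        exact (hf k hk p v hv).1
      have h2 : (m : ℝ≥0) ≤ 4 * ((Finset.Ico 2 m).filter fun i =>
          σ.proc (pathNode hP i) = σ.proc (pathNode hP (i - 1))).card := by
        exact_mod_cast le_four_mul_card_stays hP hd hg hm hσ
      calc (m : ℝ≥0) * (d * g) ≤ 4 * ((Finset.Ico 2 m).filter fun i =>
            σ.proc (pathNode hP i) = σ.proc (pathNode hP (i - 1))).card * (d * g) := by gcongr
        _ ≤ 4 * (P * cost M (zipper P d m) (zipperArch d g) T) := by
          rw [mul_assoc]
          exact mul_le_mul' le_rfl (h1.trans (totalCost_le_mul_cost M _ _ T))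
        _ = _ := by ring
    have hup : cost M (zipper P d m) (zipperArch d g) S ≤ 6 * P * m * g := by
      obtain ⟨S', hS', hcost⟩ := exists_schedule_linear_cost (d := d) (m := m) hP g
      refine (hS.2 S' hS').trans ((cost_le_totalCost M _ _ hG.L S').trans (hcost.trans ?_))
      rw [hcard]
      -- Absorbing the compute cost `1` into `g / 2` gives `P * m * g + 2 * P * m * (5 / 2) * g = 6
      -- * P * m * g`.
      have h1 : 1 ≤ g / 2 := by
        rw [le_div_iff₀ (by norm_num)]
        exact le_trans (by norm_num) hg4
      calc (P : ℝ≥0) * (d * g) + P * (d + m) * (g + (1 + g))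
          ≤ P * (m * g) + P * (m + m) * (g + (g / 2 + g)) := by gcongr
        _ = 6 * P * m * g := by
          rw [show g + (g / 2 + g) = 5 / 2 * g by field_simp; norm_num]
          field_simp
          norm_num
    rw [mul_assoc, inv_mul_le_iff₀ (by positivity), hcard]
    calc (P : ℝ≥0) * (d + m) * cost M (zipper P d m) (zipperArch d g) S
        ≤ P * (m + m) * (6 * P * m * g) := by gcongr
      _ = 12 * P ^ 2 * m * g * m := by ring
      _ ≤ 12 * P ^ 2 * m * g * (K * d) := by gcongr
      _ = 12 * P ^ 2 * K * (m * (d * g)) := by ring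
      _ ≤ 12 * P ^ 2 * (K + 1) * (4 * P * cost M (zipper P d m) (zipperArch d g) T) := by
        gcongr
        exact le_self_add
      _ = _ := by ring
  · obtain ⟨T', hT', hR, hcost⟩ := exists_refinement_quadratic_cost hP g hσ.1
    refine (hT.2.2 T' hT' hR).trans ((cost_le_totalCost M _ _ hG.L T').trans (hcost.trans ?_))
    have h1 : (1 : ℝ≥0) ≤ g := le_trans (by norm_num) hg4
    calc (Fintype.card (ZipperNode P d m) : ℝ≥0) * (((d + 1 : ℕ) : ℝ≥0) * g + (1 + g))
        = Fintype.card (ZipperNode P d m) * (d * g + 1 * g + (1 * 1 + 1 * g)) := by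
          push_cast; ring
      _ ≤ Fintype.card (ZipperNode P d m) * (d * g + d * g + (d * g + d * g)) := by gcongr
      _ = 4 * g * Fintype.card (ZipperNode P d m) * d := by ring
      _ ≤ 4 * g * Fintype.card (ZipperNode P d m) *
          (P * cost M (zipper P d m) (zipperArch d g) S) := by
        gcongr
        exact hdm.trans hOPT
      _ = _ := by ring
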